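/- Let $\mathbb{K}$ be an algebraically closed field of characteristic zero and $\mathbb{G}_a^n=(\mathbb{K}^n,+)$. An additive action on a closed subvariety $X\subseteq\mathbb{P}^m$ of dimension $n$ is an effective algebraic group action $\mathbb{G}_a^n\times\mathbb{P}^m\to\mathbb{P}^m$ that leaves $X$ invariant and has an orbit $O\subseteq X$ that is open in $X$; the boundary is $X\setminus O$, and $l(\mathbb{G}_a^n,X)$ denotes the maximal dimension of the $\mathbb{G}_a^n$-orbits contained in the boundary. Let $Q=\{q=0\}\subseteq\mathbb{P}^{n+1}$ be a hyperquadric of corank two (the kernel of the polar form of the quadratic form $q$ has dimension $2$) with $n=\dim Q\ge 5$, and let an additive action on $Q$ be given whose singularities are unfixed, i.e. $\mathrm{Sing}(Q)\not\subseteq\mathrm{Fix}(Q)$, where $\mathrm{Fix}(Q)$ is the set of points of $Q$ fixed by $\mathbb{G}_a^n$. We say that a triple $(R,W,F)$ represents the action if the following hold. $R$ is a finite-dimensional commutative local $\mathbb{K}$-algebra with maximal ideal $\mathfrak{m}$; $W$ is a hyperplane of $\mathfrak{m}$ that generates $R$ as an algebra with unit; $F$ is a symmetric bilinear form on $R$ with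 $F(1,1)=0$, $F|_{\mathfrak{m}\times\mathfrak{m}}\neq 0$ and $F(ab,c)+F(b,ac)=0$ for all $a\in W$, $b,c\in R$, such that $F(r,r)$ is not a product of two linear forms in $r$; and for some linear identification $R\cong\mathbb{K}^{n+2}$ and some basis $w_1,\dots,w_n$ of $W$, the action is $(g,[r])\mapsto[r\cdot\exp(g_1w_1+\dots+g_nw_n)]$, the form $F$ is up to a nonzero scalar the polarization of $q$ (so that $Q=\{[r]:F(r,r)=0\}$), and $O$ is the orbit of $[1_R]$. Then the action is represented by some such triple, and for every triple $(R,W,F)$ representing it, with $\mathfrak{m}$ the maximal ideal of $R$, $$l(\mathbb{G}_a^n,Q)=\dim_{\mathbb{K}}(\mathfrak{m}^2).$$ -/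

import Mathlib

open scoped LinearAlgebra.Projectivization Topology

universe u w

noncomputable section

namespace AddAct

/-! ### Zariski topology and dimension on projective space -/

/-- Projective space `ℙ^m` over `K`, as the set of lines in `K^(m+1)`. -/
abbrev Proj (K : Type u) [Field K] (m : ℕ) : Type u := ℙ K (Fin (m + 1) → K)

/-- The Zariski topology on `ℙ^m`: the nonvanishing loci of homogeneous polynomials are the basic
open sets. -/
@[reducible]
def zariski (K : Type u) [Field K] (m : ℕ) : TopologicalSpace (Proj K m) :=
  TopologicalSpace.generateFrom
    {U | ∃ (d : ℕ) (f : MvPolynomial (Fin (m + 1)) K), f.IsHomogeneous d ∧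
      U = {x : Proj K m | MvPolynomial.eval x.rep f ≠ 0}}

/-- The dimension of a subset of `ℙ^m`: the Krull dimension (supremum of the lengths of chains of
irreducible closed subsets) of the subset with the topology induced by the Zariski topology. -/
def dim {K : Type u} [Field K] {m : ℕ} (S : Set (Proj K m)) : WithBot ℕ∞ :=
  letI : TopologicalSpace (Proj K m) := zariski K m
  topologicalKrullDim S

/-- `O` is a Zariski open subset of `X`. -/
def IsOpenIn {K : Type u} [Field K] {m : ℕ} (O X : Set (Proj K m)) : Prop :=
  ∃ U : Set (Proj K m), IsOpen[zariski K m] U ∧ O = X ∩ U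

/-! ### Additive actions -/

/-- The value at `(g, v) ∈ K^n × K^(m+1)` of a tuple of `m + 1` polynomials in `m + 1` variables
whose coefficients are polynomials in `n` variables. -/
def tupleEval {K : Type u} [Field K] {n m : ℕ}
    (P : Fin (m + 1) → MvPolynomial (Fin (m + 1)) (MvPolynomial (Fin n) K))
    (g : Fin n → K) (v : Fin (m + 1) → K) : Fin (m + 1) → K :=
  fun i => MvPolynomial.eval₂ (MvPolynomial.eval g) v (P i)

/-- A map `𝔸^n × ℙ^m → ℙ^m` is a morphism of varieties: near every point it is given, in
homogeneous coordinates, by polynomials in `(g, v)` which are homogeneous in `v` of a common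
degree. -/
def IsMorphism {K : Type u} [Field K] {n m : ℕ}
    (a : (Fin n → K) → Proj K m → Proj K m) : Prop :=
  ∀ (g₀ : Fin n → K) (x₀ : Proj K m),
    ∃ (d : ℕ) (P : Fin (m + 1) → MvPolynomial (Fin (m + 1)) (MvPolynomial (Fin n) K)),
      (∀ i, (P i).IsHomogeneous d) ∧
      tupleEval P g₀ x₀.rep ≠ 0 ∧
      ∀ (g : Fin n → K) (v : Fin (m + 1) → K) (hv : v ≠ 0) (hP : tupleEval P g v ≠ 0),
        a g (Projectivization.mk K v hv) = Projectivization.mk K (tupleEval P g v) hP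

/-- An additive action on an `n`-dimensional closed subvariety `X` of `ℙ^m`: an effective algebraic
action of the vector group `𝔾_a^n = (K^n, +)` on `ℙ^m` which leaves `X` invariant and has an orbit
that is open in `X`. The open orbit (unique when `X` is irreducible) is part of the data. -/
structure AdditiveAction {K : Type u} [Field K] (n : ℕ) {m : ℕ} (X : Set (Proj K m)) where
  /-- the action map -/
  act : (Fin n → K) → Proj K m → Proj K m
  act_zero : ∀ x, act 0 x = x
  act_add : ∀ g h x, act (g + h) x = act g (act h x)
  isMorphism : IsMorphism act
  effective : ∀ g, (∀ x, act g x = x) → g = 0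
  invariant : ∀ g, ∀ x ∈ X, act g x ∈ X
  /-- the open orbit -/
  openOrbit : Set (Proj K m)
  openOrbit_isOrbit : ∃ x ∈ X, openOrbit = Set.range (fun g => act g x)
  openOrbit_isOpen : IsOpenIn openOrbit X

namespace AdditiveAction

variable {K : Type u} [Field K] {n m : ℕ} {X : Set (Proj K m)}

/-- The orbit of a point. -/
def orbit (A : AdditiveAction n X) (x : Proj K m) : Set (Proj K m) :=
  Set.range (fun g => A.act g x)

/-- The points of `X` that are fixed by the action. -/
def fixedPoints (A : AdditiveAction n X) : Set (Proj K m) :=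
  {x ∈ X | ∀ g, A.act g x = x}

/-- The boundary of the action. -/
def boundary (A : AdditiveAction n X) : Set (Proj K m) := X \ A.openOrbit

/-- The set of dimensions of the orbits in the boundary. -/
def boundaryOrbitDims (A : AdditiveAction n X) : Set (WithBot ℕ∞) :=
  {d | ∃ x ∈ A.boundary, d = dim (A.orbit x)}

end AdditiveAction

/-! ### Hyperquadrics -/

/-- The hyperquadric `{q = 0}` in projective space. -/
def hyperquadric {K : Type u} [Field K] {m : ℕ} (q : QuadraticForm K (Fin (m + 1) → K)) :
    Set (Proj K m) :=
  {x | q x.rep = 0}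

/-- The corank of the hyperquadric `{q = 0}` (in characteristic not two): the dimension of the
kernel of the polar form of `q`. -/
def corank {K : Type u} [Field K] {m : ℕ} (q : QuadraticForm K (Fin (m + 1) → K)) : ℕ :=
  Module.finrank K (LinearMap.ker q.polarBilin)

/-- The singular locus of the hyperquadric `{q = 0}`: the points of it at which the differential of
`q` vanishes, the differential of `q` at `v` being the linear form `u ↦ q (v + u) - q v - q u`. -/
def singularLocus {K : Type u} [Field K] {m : ℕ} (q : QuadraticForm K (Fin (m + 1) → K)) :
    Set (Proj K m) :=
  {x ∈ hyperquadric q | ∀ u, QuadraticMap.polar q x.rep u = 0}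

/-! ### Local algebras with invariant bilinear forms -/

/-- The exponential of an element of the maximal ideal of a finite dimensional local algebra `R`.
Such an element satisfies `r ^ (dim R) = 0`, so that this finite sum is the whole exponential
series. -/
def nilExp (K : Type u) {R : Type w} [Field K] [CommRing R] [Algebra K R] (r : R) : R :=
  ∑ k ∈ Finset.range (Module.finrank K R), ((k.factorial : K)⁻¹) • r ^ k

/-- `(R, W, F)` consists of a finite dimensional local algebra `R` with maximal ideal `𝔪`, a
hyperplane `W` of `𝔪` that generates the algebra `R` with unit, and an irreducible invariant
bilinear form `F` on `R` with respect to `W`. -/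
structure IsInvariantTriple {K : Type u} {R : Type w} [Field K] [CommRing R] [IsLocalRing R]
    [Algebra K R] (W : Submodule K R) (F : LinearMap.BilinForm K R) : Prop where
  finite : Module.Finite K R
  le_maximalIdeal : ∀ a ∈ W, a ∈ IsLocalRing.maximalIdeal R
  hyperplane : Module.finrank K W + 1 = Module.finrank K (IsLocalRing.maximalIdeal R)
  generates : Algebra.adjoin K (W : Set R) = ⊤
  symm : ∀ a b, F a b = F b a
  one_one : F 1 1 = 0
  ne_zero : ∃ a ∈ IsLocalRing.maximalIdeal R, ∃ b ∈ IsLocalRing.maximalIdeal R, F a b ≠ 0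
  invariant : ∀ a ∈ W, ∀ b c, F (a * b) c + F b (a * c) = 0
  irreducible : ¬ ∃ ℓ₁ ℓ₂ : Module.Dual K R, ∀ r, F r r = ℓ₁ r * ℓ₂ r

/-- The triple `(R, W, F)` represents the additive action `A` on the hyperquadric `{q = 0}` in
`ℙ^(n+1)`: under a linear isomorphism `φ : R ≃ K^(n+2)` and for a basis `w` of `W`
* the action is `(g, [r]) ↦ [r * exp (g₁ w₁ + ⋯ + gₙ wₙ)]`,
* `F` is, up to a nonzero scalar, the polarization of `q`, so that the hyperquadric is
  `{[r] : F r r = 0}`,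
* the open orbit is the orbit of `[1]`. -/
def Represents {K : Type u} {R : Type w} [Field K] [CommRing R] [IsLocalRing R] [Algebra K R]
    (W : Submodule K R) (F : LinearMap.BilinForm K R) {n : ℕ}
    {q : QuadraticForm K (Fin (n + 1 + 1) → K)} (A : AdditiveAction n (hyperquadric q)) : Prop :=
  IsInvariantTriple W F ∧
  ∃ (φ : R ≃ₗ[K] (Fin (n + 1 + 1) → K)) (b : Module.Basis (Fin n) K W),
    (∀ (g : Fin n → K) (r : R) (hr : φ r ≠ 0)
      (hr' : φ (r * nilExp K (∑ i, g i • (b i : R))) ≠ 0),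
      A.act g (Projectivization.mk K (φ r) hr) =
        Projectivization.mk K (φ (r * nilExp K (∑ i, g i • (b i : R)))) hr') ∧
    (∃ c : K, c ≠ 0 ∧ ∀ r, q (φ r) = c * F r r) ∧
    ∃ h1 : φ 1 ≠ 0, A.openOrbit = A.orbit (Projectivization.mk K (φ 1) h1)

end AddAct

end

noncomputable section

namespace AddAct

/-! ### The algebra of invariant triples -/

/-! Write λ for the linear form `F 1`. Invariance moves elements of `W` across `F` with a sign.
Hence `F a b = -λ(ab)` for `a ∈ W`, the form λ vanishes on `W` and on triple products from `W`, and
`ker F` is an ideal contained in `W`. Fix `s = a₀ b₀` with `a₀, b₀ ∈ W` and `λ(s) = 1`. Then 𝔪 = W ⊕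
Ks, products of two elements of `W` lie in `Ks + ker F`, and `sW ⊆ ker F` because the rank is large.

Upper bound. The orbit of `[r]` is the set of all `[r exp a]` with `a ∈ W`. It is parametrized by
the vector space `rW` through polynomials with a polynomial inverse, so its dimension is `dim rW`
(`dim_exp_orbit`). An isotropic unit is a scalar times some `exp a` with `a ∈ W`
(`exists_eq_smul_nilExp`). So every boundary point is `[r]` with `r ∈ 𝔪`, and then `rW ⊆ 𝔪²`.

Attainment. An unfixed singular point gives `p ∈ ker F` and `w₀ ∈ W` with `p w₀ ≠ 0`, so `ker F` is
spanned by `p` and `p w₀`. There is an isotropic `w ∈ W` outside `ker F` with `wp ≠ 0`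
(`exists_isotropic`), and then 𝔪² = wW (`maximalIdeal_sq_le`). If this failed, comparing two
computations of one triple product would make `w^⊥ ∩ W` totally isotropic, which is impossible since
`F` has rank at least 3 on `W` when `n ≥ 5`.

Existence of a triple. The action lifts to matrices with polynomial entries
(`exists_matrix_of_isMorphism`), which form a genuine representation (`map_add_of_projective`),
namely the exponential of commuting nilpotent matrices `N g`. These are skew for `q`, because `q` is
invariant and not merely semi-invariant. The algebra `R` generated by the `N g` acts on a vector `v`
over the open orbit, and `r ↦ r v` is bijective: onto because the open orbit spans the space,
injective because `R` is commutative. The form `F` is the polar form of `q` pulled back along this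
map. -/

theorem mem_ker_bilin_iff {K : Type u} {R : Type w} [CommRing K] [AddCommGroup R] [Module K R]
    {F : LinearMap.BilinForm K R} {a : R} : a ∈ LinearMap.ker F ↔ ∀ b, F a b = 0 := by
  rw [LinearMap.mem_ker, LinearMap.ext_iff]; rfl

/-- The counting device behind every appeal to large rank: two linear conditions that force a vector
into the radical bound the rank by two. -/
theorem finrank_le_of_functionals {K : Type u} {R : Type w} [Field K] [AddCommGroup R]
    [Module K R] {W N : Submodule K R} [Module.Finite K R] (f g : R →ₗ[K] K)
    (h : ∀ c ∈ W, f c = 0 → g c = 0 → c ∈ N) :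
    Module.finrank K W ≤ Module.finrank K N + 2 := by
  set L : W →ₗ[K] K × K := (f.prod g) ∘ₗ W.subtype with hL
  have h1 := LinearMap.finrank_range_add_finrank_ker L
  have h2 : Module.finrank K (LinearMap.range L) ≤ 2 := by
    simpa using Submodule.finrank_le (LinearMap.range L)
  have h3 : Module.finrank K (LinearMap.ker L) ≤ Module.finrank K N := by
    have h4 : (LinearMap.ker L).map W.subtype ≤ N := by
      rintro _ ⟨c, hc, rfl⟩
      have hc' : (f c, g c) = (0 : K × K) := hc
      exact h c c.2 (Prod.ext_iff.1 hc').1 (Prod.ext_iff.1 hc').2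
    rw [← Submodule.finrank_map_subtype_eq]
    exact Submodule.finrank_mono h4
  omega

section Triple

variable {K : Type u} {R : Type w} [Field K] [CommRing R] [IsLocalRing R] [Algebra K R]

theorem exists_sub_smul_one_mem_maximalIdeal [IsAlgClosed K] [Module.Finite K R] (r : R) :
    ∃ c : K, r - c • 1 ∈ IsLocalRing.maximalIdeal R := by
  have hfin : Module.Finite K (R ⧸ IsLocalRing.maximalIdeal R) :=
    Module.Finite.of_surjective
      (Ideal.Quotient.mkₐ K (IsLocalRing.maximalIdeal R)).toLinearMap Ideal.Quotient.mk_surjective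
  obtain ⟨c, hc⟩ := (IsAlgClosed.algebraMap_bijective_of_isIntegral (k := K)
    (K := R ⧸ IsLocalRing.maximalIdeal R)).2 (Ideal.Quotient.mk _ r)
  refine ⟨c, ?_⟩
  rw [← Ideal.Quotient.eq, ← hc, ← Algebra.algebraMap_eq_smul_one]
  rfl

theorem eq_zero_of_mul_one_sub_eq_zero {p a : R} (ha : a ∈ IsLocalRing.maximalIdeal R)
    (h : p * (1 - a) = 0) : p = 0 := by
  have hu : IsUnit (1 - a) := by
    by_contra hn
    have h1 : (1 - a) + a ∈ IsLocalRing.maximalIdeal R :=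
      Ideal.add_mem _ ((IsLocalRing.mem_maximalIdeal _).2 hn) ha
    rw [sub_add_cancel] at h1
    exact (IsLocalRing.maximalIdeal R).ne_top_iff_one.1 (Ideal.IsPrime.ne_top') h1
  exact (hu.mul_left_eq_zero).1 h

/-- `1 - t⁻¹ a` is a unit. Multiplication by an element of 𝔪 thus has no nonzero eigenvalue in `K`,
which is how coefficients inside `ker F` are shown to vanish. -/
theorem eq_zero_of_smul_eq_mul {p a : R} {t : K} (ht : t ≠ 0)
    (ha : a ∈ IsLocalRing.maximalIdeal R) (h : t • p = p * a) : p = 0 := by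
  apply eq_zero_of_mul_one_sub_eq_zero (p := p)
    (a := t⁻¹ • a) (Submodule.smul_of_tower_mem _ _ ha)
  have : p = t⁻¹ • (p * a) := by rw [← h, smul_smul, inv_mul_cancel₀ ht, one_smul]
  rw [mul_sub, mul_one, mul_smul_comm, ← this, sub_self]

namespace IsInvariantTriple

variable {W : Submodule K R} {F : LinearMap.BilinForm K R} (h : IsInvariantTriple W F)

include h

theorem mul_left {a : R} (ha : a ∈ W) (b c : R) : F (a * b) c = - F b (a * c) :=
  eq_neg_of_add_eq_zero_left (h.invariant a ha b c)

theorem form_mul_one {a : R} (ha : a ∈ W) (b : R) : F a b = - F 1 (a * b) := by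
  simpa using h.mul_left ha 1 b

theorem one_apply [CharZero K] {a : R} (ha : a ∈ W) : F 1 a = 0 := by
  have h1 := h.form_mul_one ha 1
  rw [mul_one, h.symm] at h1
  exact self_eq_neg.1 h1

/-- For multipliers in `W` this is invariance, and `W` generates `R`. -/
theorem mul_mem_ker {k : R} (hk : k ∈ LinearMap.ker F) (r : R) : r * k ∈ LinearMap.ker F := by
  have hr : r ∈ Algebra.adjoin K (W : Set R) := h.generates ▸ Algebra.mem_top
  induction hr using Algebra.adjoin_induction generalizing k with
  | mem a ha =>
    rw [mem_ker_bilin_iff] at hk ⊢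
    intro b
    rw [h.mul_left ha, hk, neg_zero]
  | algebraMap c =>
    rw [← Algebra.smul_def]; exact Submodule.smul_mem _ _ hk
  | add x y _ _ hx hy => rw [add_mul]; exact Submodule.add_mem _ (hx hk) (hy hk)
  | mul x y _ _ hx hy => rw [mul_assoc]; exact hx (hy hk)

theorem one_notMem_ker : (1 : R) ∉ LinearMap.ker F := by
  intro h1
  obtain ⟨a, -, b, -, hab⟩ := h.ne_zero
  have := h.mul_mem_ker h1 a
  rw [mul_one] at this
  exact hab (mem_ker_bilin_iff.1 this b)

theorem ker_le_maximalIdeal {k : R} (hk : k ∈ LinearMap.ker F) :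
    k ∈ IsLocalRing.maximalIdeal R := by
  rw [IsLocalRing.mem_maximalIdeal]
  intro hu
  obtain ⟨v, hv⟩ := hu.exists_left_inv
  exact h.one_notMem_ker (hv ▸ h.mul_mem_ker hk v)

theorem exists_one_apply_ne_zero [IsAlgClosed K] :
    ∃ x ∈ IsLocalRing.maximalIdeal R, F 1 x ≠ 0 := by
  have := h.finite
  by_contra! hc
  refine h.one_notMem_ker (mem_ker_bilin_iff.2 fun b => ?_)
  obtain ⟨c, hc'⟩ := exists_sub_smul_one_mem_maximalIdeal (K := K) b
  have := hc _ hc'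
  rw [map_sub, map_smul, h.one_one, smul_zero, sub_zero] at this
  exact this

/-- `W` lies in the kernel of `F 1` on 𝔪, a proper subspace of 𝔪, and already has codimension one in
𝔪. -/
theorem mem_of_one_apply_eq_zero [IsAlgClosed K] [CharZero K] {x : R}
    (hx : x ∈ IsLocalRing.maximalIdeal R) (hx0 : F 1 x = 0) : x ∈ W := by
  have := h.finite
  set M : Submodule K R := (IsLocalRing.maximalIdeal R).restrictScalars K with hM
  set M' : Submodule K R := M ⊓ LinearMap.ker (F 1) with hM'
  have hle : W ≤ M' := fun a ha => ⟨h.le_maximalIdeal a ha, h.one_apply ha⟩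
  have hlt : M' < M := by
    refine lt_of_le_of_ne inf_le_left fun he => ?_
    obtain ⟨y, hy, hy0⟩ := h.exists_one_apply_ne_zero
    have : y ∈ M' := he ▸ hy
    exact hy0 this.2
  have h1 := Submodule.finrank_lt_finrank_of_lt hlt
  have h2 : Module.finrank K M = Module.finrank K W + 1 := h.hyperplane.symm
  have h3 := Submodule.finrank_mono hle
  have h4 : W = M' := Submodule.eq_of_le_of_finrank_eq hle (by omega)
  rw [h4]
  exact ⟨hx, hx0⟩

theorem ker_le [IsAlgClosed K] [CharZero K] {k : R} (hk : k ∈ LinearMap.ker F) : k ∈ W :=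
  h.mem_of_one_apply_eq_zero (h.ker_le_maximalIdeal hk) (by rw [h.symm]; exact mem_ker_bilin_iff.1 hk 1)

/-- Moving `a` and then `b` across in `F (a * b) c` produces two signs, moving `c` produces only
one. -/
theorem one_mul_mul [CharZero K] {a b c : R} (ha : a ∈ W) (hb : b ∈ W) (hc : c ∈ W) :
    F 1 (a * b * c) = 0 := by
  have h1 : F (a * b) c = F 1 (a * b * c) := by
    rw [h.mul_left ha, h.form_mul_one hb, neg_neg]; congr 1; ring
  have h2 : F (a * b) c = - F 1 (a * b * c) := by
    rw [h.symm, h.form_mul_one hc]; congr 2; ring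
  exact self_eq_neg.1 (h1.symm.trans h2)

/-- If `F 1` killed all products from `W`, then `K + W` would be closed under multiplication, hence
all of `R`, and `F 1` would be zero. -/
theorem exists_one_mul_eq_one [IsAlgClosed K] [CharZero K] :
    ∃ a ∈ W, ∃ b ∈ W, F 1 (a * b) = 1 := by
  suffices hs : ∃ a ∈ W, ∃ b ∈ W, F 1 (a * b) ≠ 0 by
    obtain ⟨a, ha, b, hb, hab⟩ := hs
    refine ⟨(F 1 (a * b))⁻¹ • a, W.smul_mem _ ha, b, hb, ?_⟩
    rw [smul_mul_assoc, map_smul, smul_eq_mul, inv_mul_cancel₀ hab]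
  by_contra! hc
  have key : ∀ r : R, ∃ c : K, r - c • 1 ∈ W := by
    intro r
    have hr : r ∈ Algebra.adjoin K (W : Set R) := h.generates ▸ Algebra.mem_top
    induction hr using Algebra.adjoin_induction with
    | mem a ha => exact ⟨0, by simpa using ha⟩
    | algebraMap c => exact ⟨c, by simp [Algebra.algebraMap_eq_smul_one]⟩
    | add x y _ _ hx hy =>
      obtain ⟨c, hx⟩ := hx
      obtain ⟨d, hy⟩ := hy
      refine ⟨c + d, ?_⟩
      convert W.add_mem hx hy using 1
      rw [add_smul]; ring
    | mul x y _ _ hx hy =>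
      obtain ⟨c, hx⟩ := hx
      obtain ⟨d, hy⟩ := hy
      refine ⟨c * d, ?_⟩
      have hxy : (x - c • 1) * (y - d • 1) ∈ W :=
        h.mem_of_one_apply_eq_zero (Ideal.mul_mem_left _ _ (h.le_maximalIdeal _ hy))
          (hc _ hx _ hy)
      convert W.add_mem hxy (W.add_mem (W.smul_mem d hx) (W.smul_mem c hy)) using 1
      simp only [Algebra.smul_def, map_mul]
      ring
  obtain ⟨x, hx, hx0⟩ := h.exists_one_apply_ne_zero
  obtain ⟨c, hc'⟩ := key x
  have := h.one_apply hc'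
  rw [map_sub, map_smul, h.one_one, smul_zero, sub_zero] at this
  exact hx0 this

theorem sub_smul_mem [IsAlgClosed K] [CharZero K] {s x : R} (hs : s ∈ IsLocalRing.maximalIdeal R)
    (hs1 : F 1 s = 1) (hx : x ∈ IsLocalRing.maximalIdeal R) : x - F 1 x • s ∈ W := by
  refine h.mem_of_one_apply_eq_zero
    (Ideal.sub_mem _ hx (Submodule.smul_of_tower_mem _ _ hs)) ?_
  rw [map_sub, map_smul, hs1, smul_eq_mul, mul_one, sub_self]

theorem mul_mem_maximalIdeal {a : R} (ha : a ∈ W) (r : R) :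
    a * r ∈ IsLocalRing.maximalIdeal R :=
  Ideal.mul_mem_right _ _ (h.le_maximalIdeal a ha)

/-- `R` is spanned by `1`, `a * b` and `W`. Orthogonality of `c` to `a * b` is the vanishing of `F
1` on triple products, so only orthogonality to `W` has to be assumed. -/
theorem mem_ker_of_forall [IsAlgClosed K] [CharZero K] {c : R} (hc : c ∈ W)
    (hcW : ∀ d ∈ W, F 1 (c * d) = 0) : c ∈ LinearMap.ker F := by
  have := h.finite
  obtain ⟨a, ha, b, hb, hab⟩ := h.exists_one_mul_eq_one
  rw [mem_ker_bilin_iff]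
  have hW : ∀ d ∈ W, F c d = 0 := fun d hd => by rw [h.form_mul_one hc, hcW d hd, neg_zero]
  have hs : F c (a * b) = 0 := by
    rw [h.form_mul_one hc, mul_comm c, h.one_mul_mul ha hb hc, neg_zero]
  have h1 : F c 1 = 0 := by rw [h.symm, h.one_apply hc]
  intro r
  obtain ⟨t, ht⟩ := exists_sub_smul_one_mem_maximalIdeal (K := K) r
  have h2 := hW _ (h.sub_smul_mem (h.mul_mem_maximalIdeal ha b) hab ht)
  simpa [hs, h1] using h2

/-- The square of a product of two elements of `W` is annihilated by the linear form `F 1`, provided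
that the form has large rank. -/
theorem one_mul_self_eq_zero [IsAlgClosed K] [CharZero K]
    (hrk : Module.finrank K (LinearMap.ker F) + 2 < Module.finrank K W) {a₀ b₀ : R} (ha₀ : a₀ ∈ W)
    (hb₀ : b₀ ∈ W) (hab : F 1 (a₀ * b₀) = 1) : F 1 (a₀ * b₀ * (a₀ * b₀)) = 0 := by
  have := h.finite
  set s := a₀ * b₀ with hs
  have hsm : s ∈ IsLocalRing.maximalIdeal R := h.mul_mem_maximalIdeal ha₀ b₀
  have hsw : ∀ c ∈ W, F 1 (s * c) = 0 := fun c hc => h.one_mul_mul ha₀ hb₀ hc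
  -- Modulo `W`, each of the products `a * b` and `c * d` is a multiple of `s`, and the corrections
  -- contribute only triple products.
  have four : ∀ a ∈ W, ∀ b ∈ W, ∀ c ∈ W, ∀ d ∈ W,
      F 1 (a * b * c * d) = F 1 (a * b) * F 1 (c * d) * F 1 (s * s) := by
    intro a ha b hb c hc d hd
    have h1 := h.sub_smul_mem hsm hab (h.mul_mem_maximalIdeal ha b)
    have h2 := h.sub_smul_mem hsm hab (h.mul_mem_maximalIdeal hc d)
    set w₁ := a * b - F 1 (a * b) • s
    set w₂ := c * d - F 1 (c * d) • s
    have h3 : a * b * c * d = w₁ * c * d + F 1 (a * b) • (s * w₂)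
        + (F 1 (a * b) * F 1 (c * d)) • (s * s) := by
      simp only [w₁, w₂, Algebra.smul_def, map_mul]; ring
    rw [h3, map_add, map_add, map_smul, map_smul, h.one_mul_mul h1 hc hd, hsw _ h2]
    simp
  by_contra hκ
  -- If `F 1 (s * s) ≠ 0`, grouping the four factors in two ways splits `F 1 (c * d)` into a
  -- function of `c` times a function of `d`. The form would have rank at most one on `W`.
  have hp : ∀ c ∈ W, ∀ d ∈ W, F 1 (c * d) = F 1 (a₀ * c) * F 1 (b₀ * d) := by
    intro c hc d hd
    have h1 := four a₀ ha₀ b₀ hb₀ c hc d hd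
    have h2 := four a₀ ha₀ c hc b₀ hb₀ d hd
    have h3 : a₀ * b₀ * c * d = a₀ * c * b₀ * d := by ring
    rw [h3, h2, hab, one_mul] at h1
    exact (mul_right_cancel₀ hκ h1).symm
  have := finrank_le_of_functionals (W := W) (N := LinearMap.ker F)
    (F 1 ∘ₗ LinearMap.mulLeft K a₀) 0 (fun c hc hc0 _ => h.mem_ker_of_forall hc fun d hd => by
      rw [hp c hc d hd, show F 1 (a₀ * c) = 0 from hc0, zero_mul])
  omega

/-- Pairing with `d ∈ W` gives `F 1` of `s * (c * d)` for `s = a₀ * b₀`. Modulo `s * W` this product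
is a multiple of `s * s`, and `F 1` kills both. -/
theorem mul_mem_ker_of_mem [IsAlgClosed K] [CharZero K]
    (hrk : Module.finrank K (LinearMap.ker F) + 2 < Module.finrank K W) {a₀ b₀ : R} (ha₀ : a₀ ∈ W)
    (hb₀ : b₀ ∈ W) (hab : F 1 (a₀ * b₀) = 1) {c : R} (hc : c ∈ W) :
    a₀ * b₀ * c ∈ LinearMap.ker F := by
  have hsm : a₀ * b₀ ∈ IsLocalRing.maximalIdeal R := h.mul_mem_maximalIdeal ha₀ b₀
  refine h.mem_ker_of_forall (h.mem_of_one_apply_eq_zero (Ideal.mul_mem_right _ _ hsm)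
    (h.one_mul_mul ha₀ hb₀ hc)) fun d hd => ?_
  have h2 := h.sub_smul_mem hsm hab (h.mul_mem_maximalIdeal hc d)
  set w₂ := c * d - F 1 (c * d) • (a₀ * b₀)
  have h3 : a₀ * b₀ * c * d = a₀ * b₀ * w₂ + F 1 (c * d) • (a₀ * b₀ * (a₀ * b₀)) := by
    simp only [w₂, Algebra.smul_def]; ring
  rw [h3, map_add, map_smul, h.one_mul_mul ha₀ hb₀ h2, h.one_mul_self_eq_zero hrk ha₀ hb₀ hab]
  simp

theorem mul_self_mem_ker [IsAlgClosed K] [CharZero K]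
    (hrk : Module.finrank K (LinearMap.ker F) + 2 < Module.finrank K W) {a₀ b₀ : R} (ha₀ : a₀ ∈ W)
    (hb₀ : b₀ ∈ W) (hab : F 1 (a₀ * b₀) = 1) : a₀ * b₀ * (a₀ * b₀) ∈ LinearMap.ker F := by
  have := h.mul_mem_ker (h.mul_mem_ker_of_mem hrk ha₀ hb₀ hab hb₀) a₀
  convert this using 1; ring

/-- The difference lies in `W`, and its pairings with `W` are triple products. Modulo `ker F`, all
products from `W` therefore lie on one line. -/
theorem mul_sub_mem_ker [IsAlgClosed K] [CharZero K] {a₀ b₀ : R} (ha₀ : a₀ ∈ W)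
    (hb₀ : b₀ ∈ W) (hab : F 1 (a₀ * b₀) = 1) {a b : R} (ha : a ∈ W) (hb : b ∈ W) :
    a * b - F 1 (a * b) • (a₀ * b₀) ∈ LinearMap.ker F := by
  have hsm : a₀ * b₀ ∈ IsLocalRing.maximalIdeal R := h.mul_mem_maximalIdeal ha₀ b₀
  refine h.mem_ker_of_forall (h.sub_smul_mem hsm hab (h.mul_mem_maximalIdeal ha b)) fun d hd => ?_
  rw [sub_mul, map_sub, smul_mul_assoc, map_smul, h.one_mul_mul ha hb hd,
    h.one_mul_mul ha₀ hb₀ hd]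
  simp

end IsInvariantTriple
end Triple

/-! ### Corank two with an unfixed singular point: the square of the maximal ideal -/

section Corank

variable {K : Type u} {R : Type w} [Field K] [CommRing R] [IsLocalRing R] [Algebra K R]

/-- An isotropic vector for a symmetric bilinear form on the line `x + K y`. -/
theorem exists_isotropic_add_smul [IsAlgClosed K] [CharZero K] {V : Type*} [AddCommGroup V]
    [Module K V] (B : LinearMap.BilinForm K V) (x y : V) (hy : B y y ≠ 0) :
    ∃ t : K, B (x + t • y) (x + t • y) = 0 := by
  obtain ⟨t, ht⟩ := exists_quadratic_eq_zero (a := B y y) (b := B x y + B y x) (c := B x x) hy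
    (IsAlgClosed.exists_pow_nat_eq _ two_pos |>.imp fun _ hz => by rw [← pow_two, hz])
  refine ⟨t, ?_⟩
  rw [← ht]
  simp only [map_add, map_smul, LinearMap.add_apply, LinearMap.smul_apply, smul_eq_mul]
  ring

namespace IsInvariantTriple

variable {W : Submodule K R} {F : LinearMap.BilinForm K R} (h : IsInvariantTriple W F)

include h

section Kernel

variable (hker : Module.finrank K (LinearMap.ker F) = 2) {p w₀ : R}
  (hp : p ∈ LinearMap.ker F) (hw₀ : w₀ ∈ W) (hu : p * w₀ ≠ 0)

include hker hp hw₀ hu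

/-- Both vectors lie in the two-dimensional `ker F`. They are independent since multiplication by
`w₀ ∈ 𝔪` has no nonzero eigenvalue. -/
theorem exists_eq_smul_add_smul {x : R} (hx : x ∈ LinearMap.ker F) :
    ∃ α β : K, α • p + β • (p * w₀) = x := by
  have := h.finite
  have hli : LinearIndependent K ![p, p * w₀] := by
    rw [LinearIndependent.pair_iff]
    intro s t hst
    have hp0 : p ≠ 0 := fun h0 => hu (by rw [h0, zero_mul])
    have hs : s = 0 := by
      by_contra hs
      refine hp0 (eq_zero_of_smul_eq_mul (a := -(t • w₀)) hs
        (neg_mem (Submodule.smul_of_tower_mem _ t (h.le_maximalIdeal _ hw₀))) ?_)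
      rw [mul_neg, mul_smul_comm]
      exact eq_neg_of_add_eq_zero_left hst
    rw [hs, zero_smul, zero_add] at hst
    exact ⟨hs, (smul_eq_zero.1 hst).resolve_right hu⟩
  have hle : Submodule.span K (Set.range ![p, p * w₀]) ≤ LinearMap.ker F := by
    rw [Submodule.span_le]
    rintro _ ⟨i, rfl⟩
    fin_cases i
    · exact hp
    · have := h.mul_mem_ker hp w₀
      rwa [mul_comm] at this
  have heq := Submodule.eq_of_le_of_finrank_eq hle
    (by rw [finrank_span_eq_card hli, hker, Fintype.card_fin])
  rw [← heq, Matrix.range_cons, Matrix.range_cons, Matrix.range_empty, Set.union_empty,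
    Set.singleton_union, Submodule.mem_span_pair] at hx
  exact hx

/-- Expand the product in the basis `p, p * w₀` of the ideal `ker F`. A nonzero coefficient would be
an eigenvalue of multiplication by an element of 𝔪, first on `p` and then on `p * w₀`. -/
theorem mul_mul_eq_zero {a : R} (ha : a ∈ IsLocalRing.maximalIdeal R) : p * w₀ * a = 0 := by
  have hw := h.le_maximalIdeal _ hw₀
  have hmem : p * w₀ * a ∈ LinearMap.ker F := by
    have := h.mul_mem_ker hp (w₀ * a)
    convert this using 1; ring
  obtain ⟨α, β, hαβ⟩ := h.exists_eq_smul_add_smul hker hp hw₀ hu hmem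
  have hp0 : p ≠ 0 := fun h0 => hu (by rw [h0, zero_mul])
  have hα : α = 0 := by
    by_contra hα
    refine hp0 (eq_zero_of_smul_eq_mul (a := w₀ * a - β • w₀) hα
      (Ideal.sub_mem _ (Ideal.mul_mem_right _ _ hw) (Submodule.smul_of_tower_mem _ β hw)) ?_)
    rw [mul_sub, mul_smul_comm, ← mul_assoc, ← hαβ, add_sub_cancel_right]
  have hβ : β = 0 := by
    by_contra hβ
    refine hu (eq_zero_of_smul_eq_mul (a := a) hβ ha ?_)
    rw [← hαβ, hα, zero_smul, zero_add]
  rw [← hαβ, hα, hβ, zero_smul, zero_smul, zero_add]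

theorem exists_mul_eq_smul {a : R} (ha : a ∈ IsLocalRing.maximalIdeal R) :
    ∃ ρ : K, p * a = ρ • (p * w₀) := by
  have hw := h.le_maximalIdeal _ hw₀
  have hmem : p * a ∈ LinearMap.ker F := by
    rw [mul_comm]; exact h.mul_mem_ker hp a
  obtain ⟨α, β, hαβ⟩ := h.exists_eq_smul_add_smul hker hp hw₀ hu hmem
  have hp0 : p ≠ 0 := fun h0 => hu (by rw [h0, zero_mul])
  have hα : α = 0 := by
    by_contra hα
    refine hp0 (eq_zero_of_smul_eq_mul (a := a - β • w₀) hα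
      (Ideal.sub_mem _ ha (Submodule.smul_of_tower_mem _ β hw)) ?_)
    rw [mul_sub, mul_smul_comm, ← hαβ, add_sub_cancel_right]
  exact ⟨β, by rw [← hαβ, hα, zero_smul, zero_add]⟩

/-- There is an isotropic vector in `W` outside the kernel of the form that does not
annihilate `p`. -/
theorem exists_isotropic [IsAlgClosed K] [CharZero K] (hW : 4 < Module.finrank K W) :
    ∃ w ∈ W, F 1 (w * w) = 0 ∧ w * p ≠ 0 ∧ w ∉ LinearMap.ker F := by
  have := h.finite
  obtain ⟨φ, hφ⟩ : ∃ φ : Module.Dual K R, φ (p * w₀) ≠ 0 := by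
    by_contra! hc
    exact hu ((Module.forall_dual_apply_eq_zero_iff K _).1 hc)
  -- The annihilator of `p` in `W` has codimension at most one. Were it totally isotropic, the form
  -- would have rank at most two on `W`.
  obtain ⟨y, hyW, hyp, hyy⟩ : ∃ y ∈ W, p * y = 0 ∧ F y y ≠ 0 := by
    by_contra! hc
    have hpol : ∀ y ∈ W, p * y = 0 → ∀ z ∈ W, p * z = 0 → F y z = 0 := by
      intro y hy hy0 z hz hz0
      have h1 := hc (y + z) (W.add_mem hy hz) (by rw [mul_add, hy0, hz0, add_zero])
      rw [map_add, map_add, LinearMap.add_apply, LinearMap.add_apply, hc y hy hy0, hc z hz hz0, h.symm z y,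
        zero_add, add_zero, ← two_mul] at h1
      exact (mul_eq_zero.1 h1).resolve_left two_ne_zero
    -- Since `p * c` is a multiple of `p * w₀`, the functional `φ` detects whether `c` kills `p`.
    -- The second functional handles the direction `w₀`, which complements the annihilator of `p` in
    -- `W`.
    have := finrank_le_of_functionals (W := W) (N := LinearMap.ker F)
      (φ ∘ₗ LinearMap.mulLeft K p) (F w₀) (fun c hc hfc hgc => h.mem_ker_of_forall hc fun d hd => ?_)
    · omega
    obtain ⟨γ, hγ⟩ := h.exists_mul_eq_smul hker hp hw₀ hu (h.le_maximalIdeal _ hc)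
    have hpc : p * c = 0 := by
      have h1 : φ (p * c) = 0 := hfc
      rw [hγ, map_smul, smul_eq_mul] at h1
      rw [hγ, (mul_eq_zero.1 h1).resolve_right hφ, zero_smul]
    obtain ⟨τ, hτ⟩ := h.exists_mul_eq_smul hker hp hw₀ hu (h.le_maximalIdeal _ hd)
    have h1 := hpol c hc hpc (d - τ • w₀) (W.sub_mem hd (W.smul_mem _ hw₀))
      (by rw [mul_sub, mul_smul_comm, hτ, sub_self])
    rw [map_sub, map_smul, h.symm c w₀, hgc, smul_zero, sub_zero, h.form_mul_one hc] at h1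
    exact neg_eq_zero.1 h1
  -- Avoiding the line of `y` as well as `ker F` keeps `x + t • y` outside `ker F` for every `t`. As
  -- `p * y = 0`, it also keeps `p * (x + t • y) ≠ 0`, so `t` is free to be chosen for isotropy.
  obtain ⟨x, hxW, hxp, hx⟩ : ∃ x ∈ W, p * x ≠ 0 ∧ x ∉ LinearMap.ker F ⊔ Submodule.span K {y} := by
    obtain ⟨z, hzW, hz⟩ : ∃ z ∈ W, z ∉ LinearMap.ker F ⊔ Submodule.span K {y} := by
      by_contra! hc
      have h1 := Submodule.finrank_mono (show W ≤ LinearMap.ker F ⊔ Submodule.span K {y} from hc)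
      have h2 := Submodule.finrank_add_le_finrank_add_finrank (LinearMap.ker F)
        (Submodule.span K {y})
      have h3 := finrank_span_le_card (R := K) ({y} : Set R)
      simp only [Set.toFinset_singleton, Finset.card_singleton] at h3
      omega
    by_cases hw : w₀ ∈ LinearMap.ker F ⊔ Submodule.span K {y}
    · by_cases hzp : p * z = 0
      · refine ⟨w₀ + z, W.add_mem hw₀ hzW, by rwa [mul_add, hzp, add_zero], fun hc => hz ?_⟩
        exact (Submodule.add_mem_iff_right _ hw).1 hc
      · exact ⟨z, hzW, hzp, hz⟩
    · exact ⟨w₀, hw₀, hu, hw⟩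
  obtain ⟨t, ht⟩ := exists_isotropic_add_smul F x y hyy
  have hmem := W.add_mem hxW (W.smul_mem t hyW)
  refine ⟨x + t • y, hmem, ?_, ?_, fun hc => hx ?_⟩
  · rw [h.form_mul_one hmem] at ht
    exact neg_eq_zero.1 ht
  · rwa [mul_comm, mul_add, mul_smul_comm, hyp, smul_zero, add_zero]
  · have := Submodule.sub_mem _ (Submodule.mem_sup_left (T := Submodule.span K {y}) hc)
      (Submodule.mem_sup_right (Submodule.smul_mem _ t (Submodule.mem_span_singleton_self y)))
    rwa [add_sub_cancel_right] at this

/-- For an isotropic vector `w ∈ W` outside the kernel of the form that does not annihilate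
`p`, the square of the maximal ideal equals `w W`. -/
theorem maximalIdeal_sq_le [IsAlgClosed K] [CharZero K] (hW : 4 < Module.finrank K W) {w : R}
    (hw : w ∈ W) (hww : F 1 (w * w) = 0) (hwp : w * p ≠ 0) (hwN : w ∉ LinearMap.ker F) {x : R}
    (hx : x ∈ IsLocalRing.maximalIdeal R ^ 2) : x ∈ W.map (LinearMap.mulLeft K w) := by
  have := h.finite
  set I := W.map (LinearMap.mulLeft K w) with hI
  have hIw : ∀ a ∈ W, w * a ∈ I := fun a ha => ⟨a, ha, rfl⟩
  have hwN' := fun a ha => h.mul_mul_eq_zero hker hp hw₀ hu (a := a) ha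
  obtain ⟨c, hc, hwc⟩ : ∃ c ∈ W, F 1 (w * c) = 1 := by
    by_contra! hcon
    refine hwN (h.mem_ker_of_forall hw fun d hd => ?_)
    by_contra hne
    refine hcon ((F 1 (w * d))⁻¹ • d) (W.smul_mem _ hd) ?_
    rw [mul_smul_comm, map_smul, smul_eq_mul, inv_mul_cancel₀ hne]
  have hsm : w * c ∈ IsLocalRing.maximalIdeal R := h.mul_mem_maximalIdeal hw c
  have hrk : Module.finrank K (LinearMap.ker F) + 2 < Module.finrank K W := by omega
  have hcw : F 1 (c * w) = 1 := by rwa [mul_comm]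
  have hs : w * c ∈ I := hIw c hc
  have huI : p * w₀ ∈ I := by
    obtain ⟨ρ, hρ⟩ := h.exists_mul_eq_smul hker hp hw₀ hu (h.le_maximalIdeal _ hw)
    have hρ0 : ρ ≠ 0 := by
      rintro rfl
      rw [zero_smul, mul_comm] at hρ
      exact hwp hρ
    have := I.smul_mem ρ⁻¹ (hIw p (h.ker_le hp))
    rwa [mul_comm w, hρ, smul_smul, inv_mul_cancel₀ hρ0, one_smul] at this
  have hdec : ∀ a ∈ W, ∀ b ∈ W, a * b - F 1 (a * b) • (w * c) ∈ LinearMap.ker F :=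
    fun a ha b hb => h.mul_sub_mem_ker hw hc hwc ha hb
  have hsW : ∀ b ∈ W, w * c * b ∈ LinearMap.ker F :=
    fun b hb => h.mul_mem_ker_of_mem hrk hw hc hwc hb
  have hss : w * c * (w * c) ∈ I := by
    rw [mul_assoc]
    refine hIw _ (h.ker_le ?_)
    rw [mul_comm]
    exact hsW c hc
  -- With `s = w * c`, the decomposition of 𝔪 as `W + Ks` leaves the products in `W W`, `s W` and `K
  -- s²` to be placed in `I = w W`.
  suffices hmul : (∀ a ∈ W, ∀ b ∈ W, a * b ∈ I) ∧ ∀ b ∈ W, w * c * b ∈ I by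
    rw [pow_two] at hx
    refine Submodule.mul_induction_on hx (fun y hy z hz => ?_) (fun y z hy hz => I.add_mem hy hz)
    have h1 := h.sub_smul_mem hsm hwc hy
    have h2 := h.sub_smul_mem hsm hwc hz
    set a := y - F 1 y • (w * c)
    set b := z - F 1 z • (w * c)
    have h3 : y * z = a * b + F 1 z • (w * c * a) + F 1 y • (w * c * b)
        + (F 1 y * F 1 z) • (w * c * (w * c)) := by
      simp only [a, b, Algebra.smul_def, map_mul]; ring
    rw [h3]
    exact I.add_mem (I.add_mem (I.add_mem (hmul.1 _ h1 _ h2) (I.smul_mem _ (hmul.2 _ h1)))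
      (I.smul_mem _ (hmul.2 _ h2))) (I.smul_mem _ hss)
  -- If `p ∈ I`, then `I` contains `ker F` and `s`, hence all products from `W`.
  by_cases hpI : p ∈ I
  · have hN : ∀ k ∈ LinearMap.ker F, k ∈ I := by
      intro k hk
      obtain ⟨α, β, rfl⟩ := h.exists_eq_smul_add_smul hker hp hw₀ hu hk
      exact I.add_mem (I.smul_mem _ hpI) (I.smul_mem _ huI)
    refine ⟨fun a ha b hb => ?_, fun b hb => hN _ (hsW b hb)⟩
    have := I.add_mem (hN _ (hdec a ha b hb)) (I.smul_mem (F 1 (a * b)) hs)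
    rwa [sub_add_cancel] at this
  have hNI : ∀ k ∈ LinearMap.ker F, k ∈ I → ∃ β : K, k = β • (p * w₀) := by
    intro k hk hkI
    obtain ⟨α, β, rfl⟩ := h.exists_eq_smul_add_smul hker hp hw₀ hu hk
    have hα : α = 0 := by
      by_contra hα
      have h1 := I.smul_mem α⁻¹ ((Submodule.add_mem_iff_left I (I.smul_mem β huI)).1 hkI)
      rw [smul_smul, inv_mul_cancel₀ hα, one_smul] at h1
      exact hpI h1
    exact ⟨β, by rw [hα, zero_smul, zero_add]⟩
  -- Now `I ∩ ker F` is contained in the line of `p * w₀`, which 𝔪 annihilates. So `w * b` and its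
  -- multiple of `s` act alike on `W`. Taking `b = w`, isotropy of `w` gives `s * w = 0`.
  have hkill : ∀ b ∈ W, ∀ a ∈ W, w * b * a = F 1 (w * b) • (w * c * a) := by
    intro b hb a ha
    obtain ⟨β, hβ⟩ := hNI _ (hdec w hw b hb) (I.sub_mem (hIw b hb) (I.smul_mem _ hs))
    have h1 : (w * b - F 1 (w * b) • (w * c)) * a = 0 := by
      rw [hβ, smul_mul_assoc, hwN' _ (h.le_maximalIdeal _ ha), smul_zero]
    rw [sub_mul, smul_mul_assoc] at h1
    exact sub_eq_zero.1 h1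
  have hsw : w * c * w = 0 := by
    have h1 := hkill w hw c hc
    rw [hww, zero_smul] at h1
    rw [← h1]; ring
  have hsb : ∀ b ∈ W, w * c * b = F 1 (w * b) • (w * c * c) := by
    intro b hb
    rw [← hkill b hb c hc]; ring
  have hsI : ∀ b ∈ W, w * c * b ∈ I := by
    intro b hb
    have h1 : w * c * b = w * (c * b - F 1 (c * b) • (w * c)) := by
      rw [mul_sub, mul_smul_comm, mul_comm w (w * c), hsw, smul_zero, sub_zero, mul_assoc]
    rw [h1]
    exact hIw _ (h.ker_le (hdec c hc b hb))
  refine ⟨?_, hsI⟩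
  by_contra! hcon
  obtain ⟨a₁, ha₁, b₁, hb₁, hab₁⟩ := hcon
  -- The coefficient `γ` of `p` is read off by multiplying by `w`, which kills both `s` and `p *
  -- w₀`. It vanishes as soon as `a` or `b` is orthogonal to `w`.
  have hγ : ∀ a ∈ W, ∀ b ∈ W, ∃ γ δ : K,
      a * b = F 1 (a * b) • (w * c) + γ • p + δ • (p * w₀) ∧
      γ • (w * p) = (F 1 (w * a) * F 1 (w * b)) • (w * c * c) := by
    intro a ha b hb
    obtain ⟨γ, δ, hγδ⟩ := h.exists_eq_smul_add_smul hker hp hw₀ hu (hdec a ha b hb)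
    have h1 : a * b = F 1 (a * b) • (w * c) + γ • p + δ • (p * w₀) := by
      rw [add_assoc, hγδ]; ring
    refine ⟨γ, δ, h1, ?_⟩
    have h2 : w * a * b = γ • (w * p) := by
      generalize F 1 (a * b) = τ at h1
      calc w * a * b = w * (a * b) := mul_assoc _ _ _
        _ = τ • (w * c * w) + γ • (w * p) + δ • (p * w₀ * w) := by
          rw [h1]; simp only [Algebra.smul_def]; ring_nf
        _ = γ • (w * p) := by
          rw [hsw, hwN' _ (h.le_maximalIdeal _ hw), smul_zero, smul_zero, zero_add, add_zero]
    rw [← h2, hkill a ha b hb, hsb b hb, smul_smul]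
  -- A product outside `I` must have `γ ≠ 0`, hence `s * c ≠ 0`.
  have hscc : w * c * c ≠ 0 := by
    intro h0
    obtain ⟨γ, δ, h1, h2⟩ := hγ a₁ ha₁ b₁ hb₁
    rw [h0, smul_zero] at h2
    have hγ0 := (smul_eq_zero.1 h2).resolve_right hwp
    rw [hγ0, zero_smul, add_zero] at h1
    exact hab₁ (h1 ▸ I.add_mem (I.smul_mem _ hs) (I.smul_mem _ huI))
  -- For `a`, `b` orthogonal to `w`, computing `a * b * c` through `a * c` gives zero, and through
  -- `a * b` gives `F 1 (a * b)` times the nonzero element `s * c`.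
  have hperp : ∀ a ∈ W, F 1 (w * a) = 0 → ∀ b ∈ W, F 1 (w * b) = 0 → F 1 (a * b) = 0 := by
    intro a ha ha0 b hb hb0
    obtain ⟨γ, δ, h1, h2⟩ := hγ a ha c hc
    obtain ⟨γ', δ', h3, h4⟩ := hγ a ha b hb
    rw [ha0, zero_mul, zero_smul] at h2 h4
    have hγ0 := (smul_eq_zero.1 h2).resolve_right hwp
    have hγ0' := (smul_eq_zero.1 h4).resolve_right hwp
    have hb' := h.le_maximalIdeal _ hb
    have hc' := h.le_maximalIdeal _ hc
    have h5 : a * c * b = 0 := by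
      rw [h1, hγ0, zero_smul, add_zero, add_mul, smul_mul_assoc, smul_mul_assoc, hwN' _ hb', hsb b hb,
        hb0, zero_smul, smul_zero, smul_zero, add_zero]
    have h6 : a * b * c = F 1 (a * b) • (w * c * c) := by
      generalize F 1 (a * b) = τ at h3
      rw [h3, hγ0', zero_smul, add_zero, add_mul, smul_mul_assoc, smul_mul_assoc, hwN' _ hc',
        smul_zero, add_zero]
    rw [mul_right_comm, h5] at h6
    exact (smul_eq_zero.1 h6.symm).resolve_right hscc
  -- Since `W` is spanned by `c` and the vectors orthogonal to `w`, a vector orthogonal to both `w`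
  -- and `c` is in the radical, so the rank on `W` is at most two.
  have := finrank_le_of_functionals (W := W) (N := LinearMap.ker F)
    (F 1 ∘ₗ LinearMap.mulLeft K w) (F 1 ∘ₗ LinearMap.mulLeft K c)
    (fun b hb hfb hgb => h.mem_ker_of_forall hb fun d hd => by
      have h1 := hperp b hb hfb (d - F 1 (w * d) • c) (W.sub_mem hd (W.smul_mem _ hc))
        (by rw [mul_sub, mul_smul_comm, map_sub, map_smul, hwc, smul_eq_mul, mul_one, sub_self])
      have h2 : F 1 (b * c) = 0 := by rw [mul_comm]; exact hgb
      rwa [mul_sub, mul_smul_comm, map_sub, map_smul, h2, smul_zero, sub_zero] at h1)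
  omega

end Kernel
end IsInvariantTriple
end Corank

/-! ### Exponentials of nilpotent elements -/

section Exp

theorem pow_finrank_eq_zero {K : Type u} {R : Type w} [Field K] [CommRing R] [Algebra K R]
    [Module.Finite K R] {a : R} (ha : IsNilpotent a) : a ^ Module.finrank K R = 0 := by
  have h1 : IsNilpotent (Algebra.lmul K R a) := ha.map (Algebra.lmul K R)
  have h2 := LinearMap.aeval_self_charpoly (Algebra.lmul K R a)
  rw [(LinearMap.isNilpotent_iff_charpoly _).1 h1, map_pow, Polynomial.aeval_X, ← map_pow] at h2
  have h3 := LinearMap.congr_fun h2 1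
  simpa using h3

theorem isNilpotent_of_mem_maximalIdeal (K : Type u) {R : Type w} [Field K] [CommRing R]
    [IsLocalRing R] [Algebra K R] [Module.Finite K R] {a : R}
    (ha : a ∈ IsLocalRing.maximalIdeal R) : IsNilpotent a := by
  have : IsArtinianRing R := IsArtinianRing.of_finite K R
  obtain ⟨k, hk⟩ := IsArtinianRing.isNilpotent_jacobson_bot (R := R)
  rw [IsLocalRing.jacobson_eq_maximalIdeal ⊥ bot_ne_top] at hk
  exact ⟨k, by simpa [hk] using Ideal.pow_mem_pow ha k⟩

theorem sum_range_eq_of_pow_eq_zero {K : Type u} {R : Type w} [Field K] [Ring R]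
    [Algebra K R] {x : R} {D E : ℕ} (hD : x ^ D = 0) (hDE : D ≤ E)
    (c : ℕ → K) :
    ∑ k ∈ Finset.range E, c k • x ^ k = ∑ k ∈ Finset.range D, c k • x ^ k := by
  refine (Finset.sum_subset (Finset.range_subset_range.2 hDE) fun k _ hk => ?_).symm
  rw [pow_eq_zero_of_le (by simpa using hk) hD, smul_zero]

variable {K : Type u} {R : Type w} [Field K] [CommRing R] [Algebra K R] [Module.Finite K R]

theorem nilExp_eq_sum {x : R} {D : ℕ} (hD : x ^ D = 0) :
    nilExp K x = ∑ k ∈ Finset.range D, ((k.factorial : K)⁻¹) • x ^ k := by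
  have h1 := sum_range_eq_of_pow_eq_zero hD (le_max_left D (Module.finrank K R))
    fun k => ((k.factorial : K)⁻¹)
  have h2 := sum_range_eq_of_pow_eq_zero (pow_finrank_eq_zero (K := K) ⟨D, hD⟩)
    (le_max_right D (Module.finrank K R)) fun k => ((k.factorial : K)⁻¹)
  rw [← h1, h2]; rfl

theorem nilExp_add [CharZero K] {a b : R} (ha : IsNilpotent a) (hb : IsNilpotent b) :
    nilExp K (a + b) = nilExp K a * nilExp K b := by
  let _ : Module ℚ R := Module.compHom R (algebraMap ℚ K)
  have key : ∀ x : R, IsNilpotent x → nilExp K x = IsNilpotent.exp x := by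
    rintro x ⟨D, hD⟩
    rw [nilExp_eq_sum hD, IsNilpotent.exp_eq_sum hD]
    refine Finset.sum_congr rfl fun k _ => ?_
    change _ = (algebraMap ℚ K ((k.factorial : ℚ)⁻¹)) • x ^ k
    simp
  rw [key _ ((Commute.all a b).isNilpotent_add ha hb), key _ ha, key _ hb,
    IsNilpotent.exp_add_of_commute (Commute.all a b) ha hb]

theorem nilExp_zero : nilExp K (0 : R) = 1 := by
  rw [nilExp_eq_sum (pow_one (0 : R))]
  simp

theorem exists_nilExp_eq {a : R} (ha : IsNilpotent a) :
    ∃ z : R, nilExp K a = 1 + a + a ^ 2 * z := by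
  obtain ⟨D, hD⟩ := ha
  rw [nilExp_eq_sum (pow_eq_zero_of_le (Nat.le_add_right D 2) hD), Finset.sum_range_succ',
    Finset.sum_range_succ']
  refine ⟨∑ k ∈ Finset.range D, (((k + 1 + 1).factorial : K)⁻¹) • a ^ k, ?_⟩
  rw [Finset.mul_sum]
  have : ∀ k ∈ Finset.range D, (((k + 1 + 1).factorial : K)⁻¹) • a ^ (k + 1 + 1) =
      a ^ 2 * ((((k + 1 + 1).factorial : K)⁻¹) • a ^ k) := by
    intro k _
    rw [mul_smul_comm, ← pow_add, add_comm 2 k]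
  rw [Finset.sum_congr rfl this]
  simp
  ring

variable [CharZero K]

theorem nilExp_mul_neg {a : R} (ha : IsNilpotent a) : nilExp K a * nilExp K (-a) = 1 := by
  rw [← nilExp_add ha ha.neg, add_neg_cancel, nilExp_zero]

/-- A logarithm by successive approximation: for `μ ∈ 𝔪^k`, multiplying `1 + μ` by `exp (-μ)` leaves
`1` plus an element of `𝔪^(2k) ⊆ 𝔪^(k+1)`, and 𝔪 is nilpotent. -/
theorem exists_nilExp_eq_one_add [IsLocalRing R] {μ : R} (hμ : μ ∈ IsLocalRing.maximalIdeal R) :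
    ∃ a ∈ IsLocalRing.maximalIdeal R, nilExp K a = 1 + μ := by
  have hnil := fun (a : R) (ha : a ∈ IsLocalRing.maximalIdeal R) =>
    isNilpotent_of_mem_maximalIdeal K ha
  have : IsArtinianRing R := IsArtinianRing.of_finite K R
  obtain ⟨D, hD⟩ := IsArtinianRing.isNilpotent_jacobson_bot (R := R)
  rw [IsLocalRing.jacobson_eq_maximalIdeal ⊥ bot_ne_top] at hD
  have key : ∀ j k : ℕ, 1 ≤ k → D ≤ k + j → ∀ μ ∈ IsLocalRing.maximalIdeal R ^ k,
      ∃ a ∈ IsLocalRing.maximalIdeal R, nilExp K a = 1 + μ := by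
    intro j
    induction j with
    | zero =>
      intro k _ hk μ hμ
      refine ⟨0, Ideal.zero_mem _, ?_⟩
      have := Ideal.pow_le_pow_right hk hμ
      rw [add_zero] at hk
      have h0 : μ = 0 := by simpa [hD] using Ideal.pow_le_pow_right hk hμ
      rw [h0, nilExp_zero, add_zero]
    | succ j ih =>
      intro k hk hkj μ hμ
      have hμ1 : μ ∈ IsLocalRing.maximalIdeal R := Ideal.pow_le_self (by omega) hμ
      obtain ⟨z, hz⟩ := exists_nilExp_eq (K := K) (hnil _ (neg_mem hμ1))
      have h1 : nilExp K (-μ) * (1 + μ) - 1 ∈ IsLocalRing.maximalIdeal R ^ (k + 1) := by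
        have h2 : nilExp K (-μ) * (1 + μ) - 1 = μ ^ 2 * (z * (1 + μ) - 1) := by
          rw [hz]; ring
        rw [h2]
        refine Ideal.mul_mem_right _ _ (Ideal.pow_le_pow_right (show k + 1 ≤ k * 2 by omega) ?_)
        rw [pow_mul]
        exact Ideal.pow_mem_pow hμ 2
      obtain ⟨a, ha, ha'⟩ := ih (k + 1) (by omega) (by omega) _ h1
      refine ⟨μ + a, Ideal.add_mem _ hμ1 ha, ?_⟩
      rw [nilExp_add (hnil _ hμ1) (hnil _ ha), ha', add_sub_cancel, ← mul_assoc,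
        nilExp_mul_neg (hnil _ hμ1), one_mul]
  exact key D 1 le_rfl (by omega) μ (by simpa using hμ)

namespace IsInvariantTriple

variable [IsLocalRing R] {W : Submodule K R} {F : LinearMap.BilinForm K R}
  (h : IsInvariantTriple W F)

include h

theorem apply_nilExp_mul {a : R} (ha : a ∈ W) (x y : R) :
    F (nilExp K a * x) (nilExp K a * y) = F x y := by
  have hpow : ∀ (k : ℕ) (x y : R), F (a ^ k * x) y = F x ((-a) ^ k * y) := by
    intro k
    induction k with
    | zero => intro x y; simp
    | succ k ih =>
      intro x y
      rw [pow_succ, mul_assoc, ih, h.mul_left ha, pow_succ', neg_mul, neg_mul, map_neg, mul_assoc]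
  have hnil := isNilpotent_of_mem_maximalIdeal K (h.le_maximalIdeal a ha)
  have h1 : F (nilExp K a * x) (nilExp K a * y) = F x (nilExp K (-a) * (nilExp K a * y)) := by
    generalize nilExp K a * y = y'
    simp only [nilExp, Finset.sum_mul, map_sum, LinearMap.sum_apply, smul_mul_assoc, map_smul,
      LinearMap.smul_apply, hpow]
  rw [h1, ← mul_assoc, mul_comm (nilExp K (-a)), nilExp_mul_neg hnil, one_mul]

/-- The isotropic elements outside the maximal ideal are, up to scalars, the exponentials of the
elements of `W`. -/
theorem exists_eq_smul_nilExp [IsAlgClosed K]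
    (hrk : Module.finrank K (LinearMap.ker F) + 2 < Module.finrank K W) {r : R}
    (hr : r ∉ IsLocalRing.maximalIdeal R) (hrr : F r r = 0) :
    ∃ c : K, c ≠ 0 ∧ ∃ a ∈ W, r = c • nilExp K a := by
  obtain ⟨c, hc⟩ := exists_sub_smul_one_mem_maximalIdeal (K := K) r
  have hc0 : c ≠ 0 := by
    rintro rfl
    rw [zero_smul, sub_zero] at hc
    exact hr hc
  obtain ⟨x, hx, hx'⟩ := exists_nilExp_eq_one_add (K := K)
    (Submodule.smul_of_tower_mem (IsLocalRing.maximalIdeal R) c⁻¹ hc)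
  have hrx : r = c • nilExp K x := by
    rw [hx', smul_add, smul_smul, mul_inv_cancel₀ hc0, one_smul, add_sub_cancel]
  obtain ⟨a₀, ha₀, b₀, hb₀, hab⟩ := h.exists_one_mul_eq_one
  set s := a₀ * b₀ with hs
  have hsm : s ∈ IsLocalRing.maximalIdeal R := h.mul_mem_maximalIdeal ha₀ b₀
  have hxW := h.sub_smul_mem hsm hab hx
  set t := F 1 x with ht
  set a := x - t • s with ha
  have hts : t • s ∈ IsLocalRing.maximalIdeal R := Submodule.smul_of_tower_mem _ t hsm
  have hexp : nilExp K x = nilExp K a * nilExp K (t • s) := by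
    rw [← nilExp_add (isNilpotent_of_mem_maximalIdeal K (h.le_maximalIdeal a hxW))
      (isNilpotent_of_mem_maximalIdeal K hts), ha, sub_add_cancel]
  -- The exponential of an element of `W` is an isometry and can be dropped. Since `s * s ∈ ker F`,
  -- what remains is `F (1 + t s) (1 + t s) = 2 t`, so `t = 0`.
  have h0 : F (nilExp K (t • s)) (nilExp K (t • s)) = 0 := by
    rw [hrx, hexp, map_smul, map_smul, LinearMap.smul_apply,
      h.apply_nilExp_mul hxW] at hrr
    simpa [hc0] using hrr
  obtain ⟨z, hz⟩ := exists_nilExp_eq (K := K) (isNilpotent_of_mem_maximalIdeal K hts)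
  have hk : (t • s) ^ 2 * z ∈ LinearMap.ker F := by
    have := (LinearMap.ker F).smul_mem (t * t)
      (h.mul_mem_ker (h.mul_self_mem_ker hrk ha₀ hb₀ hab) z)
    convert this using 1
    simp only [Algebra.smul_def, map_mul]; ring
  have hss : F s s = 0 := by
    rw [hs, h.mul_left ha₀, h.form_mul_one hb₀, neg_neg,
      show b₀ * (a₀ * (a₀ * b₀)) = a₀ * b₀ * (a₀ * b₀) by ring,
      h.one_mul_self_eq_zero hrk ha₀ hb₀ hab]
  have hk' : ∀ y, F y ((t • s) ^ 2 * z) = 0 := fun y => by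
    rw [h.symm]; exact mem_ker_bilin_iff.1 hk y
  have h1 : F s 1 = 1 := by rw [h.symm, hab]
  rw [hz] at h0
  simp only [map_add, LinearMap.add_apply, hk', mem_ker_bilin_iff.1 hk, map_smul,
    LinearMap.smul_apply, h.one_one, hss, hab, h1, smul_eq_mul] at h0
  have ht0 : t = 0 := by
    have : 2 * t = 0 := by linear_combination h0
    exact (mul_eq_zero.1 this).resolve_left two_ne_zero
  refine ⟨c, hc0, a, hxW, ?_⟩
  rw [hrx, hexp, ht0, zero_smul, nilExp_zero, mul_one]

end IsInvariantTriple
end Exp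

/-! ### Dimension of polynomially parametrized subsets of projective space -/

section Dimension

/-- The density hypothesis recovers a closed set from its trace on the range and keeps traces of
irreducible sets irreducible, so chains pull back strictly. It holds for the closed points of a
Jacobson space. -/
theorem topologicalKrullDim_eq_of_isInducing {S X : Type*} [TopologicalSpace S]
    [TopologicalSpace X] {ψ : S → X} (hψ : Topology.IsInducing ψ)
    (hd : ∀ Z : Set X, IsClosed Z → closure (Z ∩ Set.range ψ) = Z) :
    topologicalKrullDim S = topologicalKrullDim X := by
  refine le_antisymm hψ.topologicalKrullDim_le ?_
  have hmeet : ∀ (Z U : Set X), IsClosed Z → IsOpen U → (Z ∩ U).Nonempty →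
      (ψ ⁻¹' Z ∩ ψ ⁻¹' U).Nonempty := by
    rintro Z U hZ hU ⟨z, hzZ, hzU⟩
    rw [← hd Z hZ] at hzZ
    obtain ⟨_, hU', hZ', s, rfl⟩ := mem_closure_iff.1 hzZ U hU hzU
    exact ⟨s, hZ', hU'⟩
  have hirr : ∀ Z : TopologicalSpace.IrreducibleCloseds X,
      IsIrreducible (ψ ⁻¹' (Z : Set X)) := by
    intro Z
    refine ⟨?_, ?_⟩
    · obtain ⟨z, hz⟩ := Z.isIrreducible.nonempty
      obtain ⟨s, hs, -⟩ := hmeet Z Set.univ Z.isClosed isOpen_univ ⟨z, hz, trivial⟩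
      exact ⟨s, hs⟩
    · rintro u v hu hv ⟨x, hxZ, hxu⟩ ⟨y, hyZ, hyv⟩
      obtain ⟨U, hU, rfl⟩ := hψ.isOpen_iff.1 hu
      obtain ⟨V, hV, rfl⟩ := hψ.isOpen_iff.1 hv
      exact hmeet Z (U ∩ V) Z.isClosed (hU.inter hV)
        (Z.isIrreducible.2 U V hU hV ⟨_, hxZ, hxu⟩ ⟨_, hyZ, hyv⟩)
  refine Order.krullDim_le_of_strictMono
    (fun Z => ⟨ψ ⁻¹' (Z : Set X), hirr Z, Z.isClosed.preimage hψ.continuous⟩) ?_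
  intro Z Z' hlt
  refine lt_of_le_of_ne (fun s hs => hlt.le hs) fun he => hlt.ne ?_
  have he' : ψ ⁻¹' (Z : Set X) = ψ ⁻¹' (Z' : Set X) :=
    congrArg (fun T : TopologicalSpace.IrreducibleCloseds S => (T : Set S)) he
  apply TopologicalSpace.IrreducibleCloseds.ext
  rw [← hd Z Z.isClosed, ← hd Z' Z'.isClosed, ← Set.image_preimage_eq_inter_range, he',
    Set.image_preimage_eq_inter_range]

variable {K : Type u} [Field K]

/-- Homogenization along a linear form which takes the value `1`. -/
theorem exists_isHomogeneous_eval_eq {σ : Type*} (ℓ : MvPolynomial σ K) (hℓ : ℓ.IsHomogeneous 1)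
    (G : MvPolynomial σ K) : ∃ (D : ℕ) (H : MvPolynomial σ K), H.IsHomogeneous D ∧
      ∀ v, MvPolynomial.eval v ℓ = 1 → MvPolynomial.eval v H = MvPolynomial.eval v G := by
  refine ⟨G.totalDegree, ∑ k ∈ Finset.range (G.totalDegree + 1),
    ℓ ^ (G.totalDegree - k) * MvPolynomial.homogeneousComponent k G,
    MvPolynomial.IsHomogeneous.sum _ _ _ fun k hk => ?_, fun v hv => ?_⟩
  · have h1 := (hℓ.pow (G.totalDegree - k)).mul
      (MvPolynomial.homogeneousComponent_isHomogeneous k G)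
    rwa [one_mul, Nat.sub_add_cancel (Nat.lt_succ_iff.1 (Finset.mem_range.1 hk))] at h1
  · conv_rhs => rw [← MvPolynomial.sum_homogeneousComponent G]
    simp [hv]

theorem eval₂_smul_of_isHomogeneous {σ A : Type*} [CommRing A] (f : A →+* K) {D : ℕ}
    {φ : MvPolynomial σ A} (hφ : φ.IsHomogeneous D) (a : K) (v : σ → K) :
    MvPolynomial.eval₂ f (a • v) φ = a ^ D * MvPolynomial.eval₂ f v φ := by
  rw [MvPolynomial.eval₂_eq, MvPolynomial.eval₂_eq, Finset.mul_sum]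
  refine Finset.sum_congr rfl fun d hd => ?_
  have hdeg : ∑ i ∈ d.support, d i = D := by
    rw [← hφ (MvPolynomial.mem_support_iff.1 hd)]
    simp [Finsupp.weight_apply, Finsupp.sum]
  simp only [Pi.smul_apply, smul_eq_mul, mul_pow]
  rw [Finset.prod_mul_distrib, Finset.prod_pow_eq_pow_sum, hdeg]
  ring

theorem eval_smul_of_isHomogeneous {σ : Type*} {D : ℕ} {φ : MvPolynomial σ K}
    (hφ : φ.IsHomogeneous D) (a : K) (v : σ → K) :
    MvPolynomial.eval (a • v) φ = a ^ D * MvPolynomial.eval v φ :=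
  eval₂_smul_of_isHomogeneous (RingHom.id K) hφ a v

theorem eval_rep_mk_ne_zero_iff {m D : ℕ} {f : MvPolynomial (Fin (m + 1)) K}
    (hf : f.IsHomogeneous D) {v : Fin (m + 1) → K} (hv : v ≠ 0) :
    MvPolynomial.eval (Projectivization.mk K v hv).rep f ≠ 0 ↔ MvPolynomial.eval v f ≠ 0 := by
  obtain ⟨a, ha⟩ := Projectivization.exists_smul_eq_mk_rep K v hv
  rw [← ha, Units.smul_def]
  rw [eval_smul_of_isHomogeneous hf]
  simp

/-- The parametrization lands in the affine chart `ℓ = 1` and has the polynomial inverse `Y`. Its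
image is therefore homeomorphic to affine `d`-space, seen as the closed points of the spectrum of
the polynomial ring. -/
theorem dim_range_mk [IsAlgClosed K] {d m : ℕ} (v : (Fin d → K) → Fin (m + 1) → K)
    (V : Fin (m + 1) → MvPolynomial (Fin d) K) (hV : ∀ y i, MvPolynomial.eval y (V i) = v y i)
    (ℓ : MvPolynomial (Fin (m + 1)) K) (hℓ : ℓ.IsHomogeneous 1)
    (hℓv : ∀ y, MvPolynomial.eval (v y) ℓ = 1)
    (Y : Fin d → MvPolynomial (Fin (m + 1)) K) (hY : ∀ y i, MvPolynomial.eval (v y) (Y i) = y i)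
    (hv : ∀ y, v y ≠ 0) :
    dim (Set.range fun y => Projectivization.mk K (v y) (hv y)) = d := by
  set e : (Fin d → K) → Proj K m := fun y => Projectivization.mk K (v y) (hv y) with he
  let _ : TopologicalSpace (Proj K m) := zariski K m
  have hsurj : ∀ s : Set.range e, ∃ y, e y = s := fun s => s.2
  choose c hc using hsurj
  have hinj : Function.Injective e := by
    intro y y' hyy
    obtain ⟨a, ha⟩ := (Projectivization.mk_eq_mk_iff' K _ _ (hv y) (hv y')).1 hyy
    have h1 : a = 1 := by
      have h2 := hℓv y
      rwa [← ha, eval_smul_of_isHomogeneous hℓ, hℓv, pow_one, mul_one] at h2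
    rw [h1, one_smul] at ha
    funext i
    rw [← hY y i, ← hY y' i, ha]
  set ψ : Set.range e → PrimeSpectrum (MvPolynomial (Fin d) K) :=
    fun s => MvPolynomial.pointToPoint (c s) with hψ
  have hmem : ∀ p s, ψ s ∈ PrimeSpectrum.basicOpen p ↔ MvPolynomial.eval (c s) p ≠ 0 := by
    intro p s
    rw [PrimeSpectrum.mem_basicOpen]
    exact (MvPolynomial.mem_vanishingIdeal_singleton_iff (c s) p).not
  have hfmem : ∀ (D : ℕ) (f : MvPolynomial (Fin (m + 1)) K), f.IsHomogeneous D →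
      ∀ s : Set.range e, MvPolynomial.eval (s : Proj K m).rep f ≠ 0 ↔
        MvPolynomial.eval (v (c s)) f ≠ 0 := by
    intro D f hf s
    conv_lhs => rw [← hc s]
    exact eval_rep_mk_ne_zero_iff hf (hv _)
  have hind : Topology.IsInducing ψ := by
    refine ⟨?_⟩
    rw [PrimeSpectrum.isTopologicalBasis_basic_opens.eq_generateFrom, induced_generateFrom_eq]
    change TopologicalSpace.induced _ (TopologicalSpace.generateFrom _) = _
    rw [induced_generateFrom_eq]
    refine le_antisymm (le_generateFrom ?_) (le_generateFrom ?_)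
    · rintro _ ⟨_, ⟨p, rfl⟩, rfl⟩
      -- A basic open set of affine space is cut out on the image by `p ∘ Y`, homogenized along `ℓ`.
      obtain ⟨D, H, hH, hHe⟩ := exists_isHomogeneous_eval_eq ℓ hℓ (MvPolynomial.bind₁ Y p)
      refine TopologicalSpace.isOpen_generateFrom_of_mem ⟨_, ⟨D, H, hH, rfl⟩, ?_⟩
      ext s
      refine (hfmem D H hH s).trans (Iff.trans ?_ (hmem p s).symm)
      rw [hHe _ (hℓv _)]
      have h1 : MvPolynomial.eval (v (c s)) (MvPolynomial.bind₁ Y p) =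
          MvPolynomial.eval (c s) p := by
        rw [MvPolynomial.eval, MvPolynomial.eval₂Hom_bind₁]
        congr 2
        funext i
        exact hY (c s) i
      rw [h1]
    · rintro _ ⟨_, ⟨D, f, hf, rfl⟩, rfl⟩
      refine TopologicalSpace.isOpen_generateFrom_of_mem
        ⟨_, ⟨MvPolynomial.bind₁ V f, rfl⟩, ?_⟩
      ext s
      refine (hmem _ s).trans (Iff.trans ?_ (hfmem D f hf s).symm)
      have h1 : MvPolynomial.eval (c s) (MvPolynomial.bind₁ V f) =
          MvPolynomial.eval (v (c s)) f := by
        rw [MvPolynomial.eval, MvPolynomial.eval₂Hom_bind₁]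
        congr 2
        funext i
        exact hV (c s) i
      rw [h1]
  have hrange : Set.range ψ = closedPoints (PrimeSpectrum (MvPolynomial (Fin d) K)) := by
    ext P
    rw [mem_closedPoints_iff, PrimeSpectrum.isClosed_singleton_iff_isMaximal,
      MvPolynomial.isMaximal_iff_eq_vanishingIdeal_singleton]
    constructor
    · rintro ⟨s, rfl⟩
      exact ⟨c s, rfl⟩
    · rintro ⟨y, hy⟩
      refine ⟨⟨e y, y, rfl⟩, ?_⟩
      have : c ⟨e y, y, rfl⟩ = y := hinj (hc _)
      ext1
      rw [hψ, hy]
      simp only [this]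
      rfl
  change topologicalKrullDim (Set.range e) = _
  rw [topologicalKrullDim_eq_of_isInducing hind, PrimeSpectrum.topologicalKrullDim_eq_ringKrullDim,
    MvPolynomial.ringKrullDim_of_isNoetherianRing, ringKrullDim_eq_zero_of_field]
  · simp
  · intro Z hZ
    rw [hrange, JacobsonSpace.closure_inter_closedPoints_eq_closure hZ.isLocallyClosed,
      hZ.closure_eq]

end Dimension

/-! ### Dimension of the orbits -/

section Orbits

variable {K : Type u} [Field K]

/-- A nilpotent element is a polynomial in its exponential. -/
theorem mem_adjoin_exp {A : Type*} [CommRing A] [Algebra K A] {x : A} {D : ℕ} (hD : x ^ D = 0) :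
    x ∈ Algebra.adjoin K {∑ k ∈ Finset.range D, ((k.factorial : K)⁻¹) • x ^ k} := by
  set E := ∑ k ∈ Finset.range D, ((k.factorial : K)⁻¹) • x ^ k with hE
  set T := Algebra.adjoin K {E}
  have hET : E ∈ T := Algebra.subset_adjoin rfl
  obtain ⟨q, hq⟩ : ∃ q : Polynomial K, E - 1 = x * (1 + x * Polynomial.aeval x q) := by
    refine ⟨∑ k ∈ Finset.range D,
      Polynomial.C (((k + 1 + 1).factorial : K)⁻¹) * Polynomial.X ^ k, ?_⟩
    rw [hE, ← sum_range_eq_of_pow_eq_zero hD (Nat.le_add_right D 2), Finset.sum_range_succ',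
      Finset.sum_range_succ', map_sum, Finset.mul_sum]
    have : ∀ k ∈ Finset.range D, x * Polynomial.aeval x
        (Polynomial.C (((k + 1 + 1).factorial : K)⁻¹) * Polynomial.X ^ k) =
          (((k + 1 + 1).factorial : K)⁻¹) • x ^ (k + 1) := by
      intro k _
      simp only [map_mul, Polynomial.aeval_C, map_pow, Polynomial.aeval_X, Algebra.smul_def]
      ring
    rw [Finset.sum_congr rfl this, mul_add, Finset.mul_sum]
    have : ∀ k ∈ Finset.range D, x * (((k + 1 + 1).factorial : K)⁻¹) • x ^ (k + 1) =
        (((k + 1 + 1).factorial : K)⁻¹) • x ^ (k + 1 + 1) := by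
      intro k _
      rw [mul_smul_comm, ← pow_succ']
    rw [Finset.sum_congr rfl this]
    simp
    ring
  -- Descending induction on the order in `x`: `(E - 1) ^ k` agrees with `x ^ k` up to order `k +
  -- 1`, and powers from `D` on vanish.
  have key : ∀ j k : ℕ, 1 ≤ k → D ≤ k + j → ∀ p : Polynomial K,
      x ^ k * Polynomial.aeval x p ∈ T := by
    intro j
    induction j with
    | zero =>
      intro k _ hk p
      rw [pow_eq_zero_of_le (by simpa using hk) hD, zero_mul]
      exact T.zero_mem
    | succ j ih =>
      intro k hk hkj p
      have hx : x ^ k ∈ T := by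
        obtain ⟨y, hy⟩ := sub_one_dvd_pow_sub_one (1 + Polynomial.X * q) k
        have h1 : (1 + x * Polynomial.aeval x q) ^ k =
            1 + x * Polynomial.aeval x (q * y) := by
          have h2 := congrArg (Polynomial.aeval x) hy
          simp only [map_sub, map_pow, map_add, map_one, map_mul, Polynomial.aeval_X] at h2 ⊢
          linear_combination h2
        have h3 : x ^ k = (E - 1) ^ k - x ^ (k + 1) * Polynomial.aeval x (q * y) := by
          rw [hq, mul_pow, h1]; ring
        rw [h3]
        exact T.sub_mem (T.pow_mem (T.sub_mem hET T.one_mem) k)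
          (ih (k + 1) (by omega) (by omega) _)
      have h4 : x ^ k * Polynomial.aeval x p =
          p.coeff 0 • x ^ k + x ^ (k + 1) * Polynomial.aeval x p.divX := by
        conv_lhs => rw [← Polynomial.X_mul_divX_add p]
        simp only [map_add, map_mul, Polynomial.aeval_X, Polynomial.aeval_C, Algebra.smul_def]
        ring
      rw [h4]
      exact T.add_mem (T.smul_mem hx _) (ih (k + 1) (by omega) (by omega) _)
  simpa using key D 1 le_rfl (by omega) 1

/-- The maps `f : Y → R` such that all the linear coordinates of `r * f` belong to the algebra `S`
of functions. -/
def regularMaps {Y R : Type*} [CommRing R] [Algebra K R] [Module.Finite K R]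
    (S : Subalgebra K (Y → K)) (r : R) : Subalgebra K (Y → R) where
  carrier := {f | ∀ ℓ : Module.Dual K R, (fun y => ℓ (r * f y)) ∈ S}
  mul_mem' := by
    intro f g hf hg ℓ
    -- Expanding `r * f` in a basis `r * x i` of the ideal generated by `r` turns `r * f * g` into a
    -- combination of the `x i * (r * g)` with coefficients in `S`.
    set β := Module.finBasis K (LinearMap.range (LinearMap.mulLeft K r))
    have hβ : ∀ i, ∃ x, r * x = β i := fun i => (β i).2
    choose x hx using hβ
    have hγ : ∀ i, ∃ γ : R →ₗ[K] K,
        γ ∘ₗ (LinearMap.range (LinearMap.mulLeft K r)).subtype = β.coord i :=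
      fun i => LinearMap.exists_extend _
    choose γ hγ using hγ
    have h1 : (fun y => ℓ (r * (f * g) y)) =
        ∑ i, (fun y => γ i (r * f y)) * fun y => (ℓ ∘ₗ LinearMap.mulLeft K (x i)) (r * g y) := by
      funext y
      have h2 := β.sum_repr ⟨r * f y, f y, rfl⟩
      have h3 : ∑ i, γ i (r * f y) • (r * x i) = r * f y := by
        refine Eq.trans ?_ (congrArg Subtype.val h2)
        rw [AddSubmonoidClass.coe_finsetSum]
        refine Finset.sum_congr rfl fun i _ => ?_
        rw [Submodule.coe_smul, hx]
        congr 1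
        exact LinearMap.congr_fun (hγ i) ⟨r * f y, f y, rfl⟩
      rw [Pi.mul_apply, ← mul_assoc]
      conv_lhs => rw [← h3]
      simp only [Finset.sum_mul, map_sum, smul_mul_assoc, map_smul, Finset.sum_apply, Pi.mul_apply,
        smul_eq_mul, LinearMap.comp_apply, LinearMap.mulLeft_apply]
      refine Finset.sum_congr rfl fun i _ => ?_
      congr 2
      ring
    rw [h1]
    exact S.sum_mem fun i _ => S.mul_mem (hf _) (hg _)
  add_mem' := by
    intro f g hf hg ℓ
    convert S.add_mem (hf ℓ) (hg ℓ) using 1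
    funext y
    simp [mul_add]
  algebraMap_mem' := by
    intro c ℓ
    exact S.algebraMap_mem (ℓ (r * algebraMap K R c))

/-- The algebra of functions generated by a family of functions consists of the polynomials in
them. -/
theorem mem_range_aeval_iff {Y σ : Type*} (v : Y → σ → K) (f : Y → K) :
    f ∈ (MvPolynomial.aeval (R := K) fun i y => v y i).range ↔
      ∃ p : MvPolynomial σ K, ∀ y, MvPolynomial.eval (v y) p = f y := by
  have h1 : ∀ (p : MvPolynomial σ K) (y : Y),
      MvPolynomial.aeval (R := K) (fun i y => v y i) p y = MvPolynomial.eval (v y) p := by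
    intro p y
    induction p using MvPolynomial.induction_on with
    | C a => simp
    | add p q hp hq => simp [hp, hq]
    | mul_X p i hp => simp [hp]
  constructor
  · rintro ⟨p, rfl⟩
    exact ⟨p, fun y => (h1 p y).symm⟩
  · rintro ⟨p, hp⟩
    exact ⟨p, funext fun y => (h1 p y).trans (hp y)⟩

theorem exists_isHomogeneous_one_eval {m : ℕ} (ℓ : Module.Dual K (Fin m → K)) :
    ∃ p : MvPolynomial (Fin m) K, p.IsHomogeneous 1 ∧ ∀ v, MvPolynomial.eval v p = ℓ v := by
  refine ⟨∑ i, MvPolynomial.C (ℓ fun j => if i = j then 1 else 0) * MvPolynomial.X i,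
    MvPolynomial.IsHomogeneous.sum _ _ _ fun i _ => ?_, fun v => ?_⟩
  · simpa using (MvPolynomial.isHomogeneous_C (Fin m) (ℓ fun j => if i = j then 1 else 0)).mul
      (MvPolynomial.isHomogeneous_X K i)
  · rw [LinearMap.pi_apply_eq_sum_univ ℓ v]
    simp [mul_comm]

variable [CharZero K] {R : Type w} [CommRing R] [IsLocalRing R] [Algebra K R]

theorem mul_nilExp_ne_zero [Module.Finite K R] {r a : R} (hr : r ≠ 0)
    (ha : a ∈ IsLocalRing.maximalIdeal R) : r * nilExp K a ≠ 0 := by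
  intro h0
  have := nilExp_mul_neg (K := K) (isNilpotent_of_mem_maximalIdeal K ha)
  apply hr
  rw [← mul_one r, ← this, ← mul_assoc, h0, zero_mul]

/-- `exp a = exp b * exp (a - b)`, and `exp (a - b) - 1` is a multiple of `a - b`, which `r` kills.
Orbits can thus be parametrized by `r W` instead of `W`. -/
theorem mul_nilExp_congr [Module.Finite K R] {r a b : R} (ha : a ∈ IsLocalRing.maximalIdeal R)
    (hb : b ∈ IsLocalRing.maximalIdeal R) (hab : r * a = r * b) :
    r * nilExp K a = r * nilExp K b := by
  have hc : r * (a - b) = 0 := by rw [mul_sub, hab, sub_self]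
  have hnil := fun (x : R) (hx : x ∈ IsLocalRing.maximalIdeal R) =>
    isNilpotent_of_mem_maximalIdeal K hx
  have hcm := Ideal.sub_mem _ ha hb
  obtain ⟨z, hz⟩ := exists_nilExp_eq (K := K) (hnil _ hcm)
  have h1 : nilExp K a = nilExp K b * nilExp K (a - b) := by
    rw [← nilExp_add (hnil _ hb) (hnil _ hcm), add_sub_cancel]
  rw [h1, hz]
  linear_combination (nilExp K b * (1 + (a - b) * z)) * hc

/-- Coordinates `y` on `r W` lift linearly to `a y ∈ W`, and `r * exp (a y)` is polynomial in `y`.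
For the inverse, `a` is a polynomial in `exp a`, and `regularMaps` is a subalgebra, so the
coordinates of `r * a y` are polynomials in those of `r * exp (a y)`. -/
theorem dim_exp_orbit [IsAlgClosed K] [Module.Finite K R] {m : ℕ} (φ : R ≃ₗ[K] (Fin (m + 1) → K))
    (W : Submodule K R) (hW : ∀ a ∈ W, a ∈ IsLocalRing.maximalIdeal R) {r : R} (hr : r ≠ 0) :
    dim {x : Proj K m | ∃ a ∈ W, ∃ hx : φ (r * nilExp K a) ≠ 0,
      x = Projectivization.mk K (φ (r * nilExp K a)) hx} =
      (Module.finrank K (W.map (LinearMap.mulLeft K r)) : ℕ) := by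
  set β := Module.finBasis K (W.map (LinearMap.mulLeft K r))
  have hβ : ∀ i, ∃ x ∈ W, r * x = β i := fun i => (β i).2
  choose e he hre using hβ
  set a : (Fin (Module.finrank K (W.map (LinearMap.mulLeft K r))) → K) → R :=
    fun y => ∑ i, y i • e i with ha
  have haW : ∀ y, a y ∈ W := fun y => W.sum_mem fun i _ => W.smul_mem _ (he i)
  have hra : ∀ y, r * a y = ∑ i, y i • (β i : R) := fun y => by
    simp only [ha, Finset.mul_sum, mul_smul_comm, hre]
  have hnil : ∀ y, a y ^ Module.finrank K R = 0 := fun y =>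
    pow_finrank_eq_zero (isNilpotent_of_mem_maximalIdeal K (hW _ (haW y)))
  set v := fun y => φ (r * nilExp K (a y)) with hv
  have hv0 : ∀ y, v y ≠ 0 := fun y => by
    simpa [hv] using mul_nilExp_ne_zero hr (hW _ (haW y))
  have hset : {x : Proj K m | ∃ a ∈ W, ∃ hx : φ (r * nilExp K a) ≠ 0,
      x = Projectivization.mk K (φ (r * nilExp K a)) hx} =
      Set.range fun y => Projectivization.mk K (v y) (hv0 y) := by
    ext x
    constructor
    · rintro ⟨b, hb, hx, rfl⟩
      refine ⟨β.repr ⟨r * b, b, hb, rfl⟩, ?_⟩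
      have h1 : r * a (β.repr ⟨r * b, b, hb, rfl⟩) = r * b := by
        rw [hra]
        have := congrArg Subtype.val (β.sum_repr ⟨r * b, b, hb, rfl⟩)
        rw [AddSubmonoidClass.coe_finsetSum] at this
        exact this
      have h2 := mul_nilExp_congr (K := K) (hW _ (haW _)) (hW _ hb) h1
      simp only [hv, h2]
    · rintro ⟨y, rfl⟩
      exact ⟨a y, haW y, hv0 y, rfl⟩
  have hreg : ∀ (S : Subalgebra K (_ → K)) (r' : R),
      a ∈ regularMaps S r' ↔ (fun y => nilExp K (a y)) ∈ regularMaps S r' := by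
    intro S r'
    have hE : (fun y => nilExp K (a y)) =
        ∑ k ∈ Finset.range (Module.finrank K R), ((k.factorial : K)⁻¹) • a ^ k := by
      funext y
      simp [nilExp]
    rw [hE]
    refine ⟨fun h => Subalgebra.sum_mem _ fun k _ => Subalgebra.smul_mem _
      (Subalgebra.pow_mem _ h k) _, fun h => ?_⟩
    exact Algebra.adjoin_le (Set.singleton_subset_iff.2 h)
      (mem_adjoin_exp (K := K) (show a ^ Module.finrank K R = 0 from funext hnil))
  rw [hset]
  have hV : ∀ i, ∃ p : MvPolynomial (Fin (Module.finrank K (W.map (LinearMap.mulLeft K r)))) K,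
      ∀ y, MvPolynomial.eval y p = v y i := by
    intro i
    have h1 : a ∈ regularMaps ((MvPolynomial.aeval (R := K) fun i y => y i).range) r := by
      intro ℓ
      rw [mem_range_aeval_iff (fun y => y)]
      refine ⟨∑ i, MvPolynomial.C (ℓ (r * e i)) * MvPolynomial.X i, fun y => ?_⟩
      simp [ha, Finset.mul_sum, mul_comm]
    have h2 := (hreg _ _).1 h1 (LinearMap.proj i ∘ₗ φ.toLinearMap)
    exact (mem_range_aeval_iff (fun y => y) _).1 h2
  choose V hV using hV
  -- As `r ∉ r 𝔪`, there is a linear form equal to `1` at `r` and zero on `r 𝔪`. It is `1` along the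
  -- whole parametrization and supplies the affine chart.
  obtain ⟨lam, hlam, hlamr⟩ : ∃ lam : Module.Dual K R, lam r = 1 ∧
      ∀ x ∈ IsLocalRing.maximalIdeal R, lam (r * x) = 0 := by
    set M : Submodule K R := ((IsLocalRing.maximalIdeal R).restrictScalars K).map
      (LinearMap.mulLeft K r) with hM
    have hrM : r ∉ M := by
      rintro ⟨x, hx, hrx⟩
      refine hr (eq_zero_of_mul_one_sub_eq_zero hx ?_)
      rw [mul_sub, mul_one, sub_eq_zero]
      exact hrx.symm
    obtain ⟨f, hf0, hf⟩ := LinearMap.exists_extend_of_notMem (0 : M →ₗ[K] K) hrM 1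
    exact ⟨f, hf, fun x hx => LinearMap.congr_fun hf0 ⟨r * x, x, hx, rfl⟩⟩
  obtain ⟨ℓ, hℓ, hℓv⟩ := exists_isHomogeneous_one_eval (lam ∘ₗ φ.symm.toLinearMap)
  have hY : ∀ i, ∃ p : MvPolynomial (Fin (m + 1)) K, ∀ y, MvPolynomial.eval (v y) p = y i := by
    intro i
    have h1 : (fun y => nilExp K (a y)) ∈
        regularMaps ((MvPolynomial.aeval (R := K) fun i y => v y i).range) r := by
      intro ℓ'
      rw [mem_range_aeval_iff]
      obtain ⟨p, -, hp⟩ := exists_isHomogeneous_one_eval (ℓ' ∘ₗ φ.symm.toLinearMap)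
      exact ⟨p, fun y => by rw [hp]; simp [hv]⟩
    obtain ⟨γ, hγ⟩ := LinearMap.exists_extend (β.coord i)
    obtain ⟨p, hp⟩ := (mem_range_aeval_iff _ _).1 ((hreg _ _).2 h1 γ)
    refine ⟨p, fun y => ?_⟩
    rw [hp, hra, map_sum]
    have : ∀ j, γ (β j : R) = β.coord i (β j) := fun j => LinearMap.congr_fun hγ (β j)
    simp [this, Finsupp.single_apply]
  choose Y hY using hY
  refine dim_range_mk v V (fun y i => hV i y) ℓ hℓ (fun y => ?_) Y (fun y i => hY i y) hv0
  obtain ⟨z, hz⟩ := exists_nilExp_eq (K := K) ⟨_, hnil y⟩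
  rw [hℓv]
  simp only [hv, LinearMap.comp_apply, LinearEquiv.coe_coe, LinearEquiv.symm_apply_apply]
  rw [hz, show r * (1 + a y + a y ^ 2 * z) = r + r * (a y * (1 + a y * z)) by ring, map_add, hlam,
    hlamr _ (Ideal.mul_mem_right _ _ (hW _ (haW y))), add_zero]

end Orbits

/-! ### The maximal dimension of the orbits in the boundary -/

section Boundary

variable {K : Type u} [Field K]

theorem mk_mem_hyperquadric_iff {m : ℕ} {q : QuadraticForm K (Fin (m + 1) → K)}
    {v : Fin (m + 1) → K} (hv : v ≠ 0) : Projectivization.mk K v hv ∈ hyperquadric q ↔ q v = 0 := by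
  obtain ⟨a, ha⟩ := Projectivization.exists_smul_eq_mk_rep K v hv
  change q (Projectivization.mk K v hv).rep = 0 ↔ _
  rw [← ha, Units.smul_def, QuadraticMap.map_smul]
  simp

theorem finrank_ker_eq_corank [CharZero K] {V : Type*} [AddCommGroup V] [Module K V] {F : LinearMap.BilinForm K V}
    (hF : ∀ a b, F a b = F b a) {m : ℕ} {q : QuadraticForm K (Fin (m + 1) → K)}
    (φ : V ≃ₗ[K] (Fin (m + 1) → K)) {c : K} (hc : c ≠ 0) (hq : ∀ r, q (φ r) = c * F r r) :
    Module.finrank K (LinearMap.ker F) = corank q := by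
  have hpol : ∀ a b, QuadraticMap.polar q (φ a) (φ b) = 2 * c * F a b := by
    intro a b
    rw [QuadraticMap.polar, ← map_add, hq, hq, hq, map_add, map_add, LinearMap.add_apply,
      LinearMap.add_apply, hF b a]
    ring
  have hmap : LinearMap.ker q.polarBilin = (LinearMap.ker F).map φ.toLinearMap := by
    ext x
    rw [Submodule.mem_map_equiv, mem_ker_bilin_iff, mem_ker_bilin_iff]
    constructor
    · intro hx b
      have h1 := hx (φ b)
      rw [QuadraticMap.polarBilin_apply_apply, ← φ.apply_symm_apply x, hpol] at h1
      exact (mul_eq_zero.1 h1).resolve_left (mul_ne_zero two_ne_zero hc)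
    · intro hx b
      rw [QuadraticMap.polarBilin_apply_apply, ← φ.apply_symm_apply x, ← φ.apply_symm_apply b,
        hpol, hx, mul_zero]
  rw [corank, hmap]
  exact (LinearEquiv.finrank_map_eq φ _).symm

variable [IsAlgClosed K] [CharZero K] {R : Type w} [CommRing R] [IsLocalRing R] [Algebra K R]

/-- Orbit dimensions are `dim r W`. Boundary points have `r ∈ 𝔪`, which gives the upper bound, and
the isotropic `w` with `w W = 𝔪²` attains it. -/
theorem isGreatest_boundaryOrbitDims {n : ℕ} (hn : 5 ≤ n)
    {q : QuadraticForm K (Fin (n + 1 + 1) → K)} (hq : corank q = 2)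
    {A : AdditiveAction n (hyperquadric q)} (hsing : ¬ singularLocus q ⊆ A.fixedPoints)
    {W : Submodule K R} {F : LinearMap.BilinForm K R} (hrep : Represents W F A) :
    IsGreatest A.boundaryOrbitDims
      ((Module.finrank K ↥((IsLocalRing.maximalIdeal R) ^ 2) : ℕ) : WithBot ℕ∞) := by
  obtain ⟨h, φ, b, hact, ⟨c, hc, hqF⟩, h1, hO⟩ := hrep
  have := h.finite
  have hWn : Module.finrank K W = n := by rw [Module.finrank_eq_card_basis b, Fintype.card_fin]
  have hker : Module.finrank K (LinearMap.ker F) = 2 := by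
    rw [finrank_ker_eq_corank h.symm φ hc hqF, hq]
  have hrk : Module.finrank K (LinearMap.ker F) + 2 < Module.finrank K W := by omega
  have hsum : ∀ g : Fin n → K, ∑ i, g i • (b i : R) ∈ W :=
    fun g => W.sum_mem fun i _ => W.smul_mem _ (b i).2
  have hne : ∀ {r a : R}, φ r ≠ 0 → a ∈ W → φ (r * nilExp K a) ≠ 0 := fun hr ha =>
    (map_ne_zero_iff φ φ.injective).2 (mul_nilExp_ne_zero
      ((map_ne_zero_iff φ φ.injective).1 hr) (h.le_maximalIdeal _ ha))
  have horbit : ∀ (r : R) (hr : φ r ≠ 0), A.orbit (Projectivization.mk K (φ r) hr) =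
      {x | ∃ a ∈ W, ∃ hx : φ (r * nilExp K a) ≠ 0,
        x = Projectivization.mk K (φ (r * nilExp K a)) hx} := by
    intro r hr
    ext x
    constructor
    · rintro ⟨g, rfl⟩
      exact ⟨_, hsum g, hne hr (hsum g), hact g r hr (hne hr (hsum g))⟩
    · rintro ⟨a, ha, hx, rfl⟩
      have h2 : ∑ i, b.repr ⟨a, ha⟩ i • (b i : R) = a := by
        have := congrArg Subtype.val (b.sum_repr ⟨a, ha⟩)
        rwa [AddSubmonoidClass.coe_finsetSum] at this
      refine ⟨b.repr ⟨a, ha⟩, ?_⟩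
      have h3 := hact (b.repr ⟨a, ha⟩) r hr (by rw [h2]; exact hx)
      simp only [h2] at h3
      exact h3
  have hdim : ∀ (r : R) (hr : φ r ≠ 0), dim (A.orbit (Projectivization.mk K (φ r) hr)) =
      (Module.finrank K (W.map (LinearMap.mulLeft K r)) : ℕ) := fun r hr => by
    rw [horbit, dim_exp_orbit φ W h.le_maximalIdeal ((map_ne_zero_iff φ φ.injective).1 hr)]
  have hle : ∀ r ∈ IsLocalRing.maximalIdeal R, W.map (LinearMap.mulLeft K r) ≤
      (IsLocalRing.maximalIdeal R ^ 2).restrictScalars K := by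
    rintro r hr _ ⟨a, ha, rfl⟩
    change r * a ∈ IsLocalRing.maximalIdeal R ^ 2
    rw [pow_two]
    exact Ideal.mul_mem_mul hr (h.le_maximalIdeal _ ha)
  have hrepr : ∀ x : Proj K (n + 1), ∃ (r : R) (hr : φ r ≠ 0),
      x = Projectivization.mk K (φ r) hr ∧ φ r = x.rep := by
    intro x
    refine ⟨φ.symm x.rep, by simpa using x.rep_nonzero, ?_, φ.apply_symm_apply _⟩
    conv_lhs => rw [← x.mk_rep]
    simp only [LinearEquiv.apply_symm_apply]
  constructor
  -- A singular point is `[r]` with `r ∈ ker F`. If `r` annihilated `W`, every `r * exp a` would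
  -- equal `r` and the point would be fixed.
  · obtain ⟨p, hp, w₀, hw₀, hu⟩ : ∃ p ∈ LinearMap.ker F, ∃ w₀ ∈ W, p * w₀ ≠ 0 := by
      obtain ⟨x, hx, hxfix⟩ := Set.not_subset.1 hsing
      obtain ⟨r, hr, hxr, hrx⟩ := hrepr x
      refine ⟨r, ?_, ?_⟩
      · rw [mem_ker_bilin_iff]
        intro y
        have h2 := hx.2 (φ y)
        rw [← hrx, QuadraticMap.polar, ← map_add, hqF, hqF, hqF, map_add, map_add,
          LinearMap.add_apply, LinearMap.add_apply, h.symm y r] at h2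
        have h3 : 2 * c * F r y = 0 := by linear_combination h2
        exact (mul_eq_zero.1 h3).resolve_left (mul_ne_zero two_ne_zero hc)
      · by_contra! hcon
        refine hxfix ⟨hx.1, fun g => ?_⟩
        have h2 : r * nilExp K (∑ i, g i • (b i : R)) = r := by
          rw [mul_nilExp_congr (h.le_maximalIdeal _ (hsum g)) (Ideal.zero_mem _)
            (by rw [hcon _ (hsum g), mul_zero]), nilExp_zero, mul_one]
        have h3 := hact g r hr (by rwa [h2])
        simp only [h2] at h3
        rw [hxr, h3]
    obtain ⟨w, hw, hww, hwp, hwN⟩ := h.exists_isotropic hker hp hw₀ hu (by omega)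
    have hw0 : φ w ≠ 0 := by
      rw [map_ne_zero_iff φ φ.injective]
      rintro rfl
      exact hwN (Submodule.zero_mem _)
    refine ⟨Projectivization.mk K (φ w) hw0, ⟨?_, ?_⟩, ?_⟩
    · rw [mk_mem_hyperquadric_iff, hqF, h.form_mul_one hw, hww, neg_zero, mul_zero]
    · rw [hO, horbit 1 h1]
      rintro ⟨a, ha, hx, hxe⟩
      obtain ⟨t, ht⟩ := (Projectivization.mk_eq_mk_iff' K _ _ _ _).1 hxe
      rw [← map_smul, one_mul] at ht
      have h2 : t • nilExp K a = w := φ.injective ht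
      have h3 : nilExp K a ∈ IsLocalRing.maximalIdeal R := by
        have ht0 : t ≠ 0 := by
          rintro rfl
          rw [zero_smul] at h2
          exact hw0 (by rw [← h2, map_zero])
        have := Submodule.smul_of_tower_mem (IsLocalRing.maximalIdeal R) t⁻¹
          (h.le_maximalIdeal _ hw)
        rwa [← h2, smul_smul, inv_mul_cancel₀ ht0, one_smul] at this
      refine (IsLocalRing.maximalIdeal R).ne_top_iff_one.1 (Ideal.IsPrime.ne_top') ?_
      rw [← nilExp_mul_neg (K := K)
        (isNilpotent_of_mem_maximalIdeal K (h.le_maximalIdeal _ ha))]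
      exact Ideal.mul_mem_right _ _ h3
    · rw [hdim]
      have heq : W.map (LinearMap.mulLeft K w) =
          (IsLocalRing.maximalIdeal R ^ 2).restrictScalars K :=
        le_antisymm (hle w (h.le_maximalIdeal _ hw)) fun x hx =>
          h.maximalIdeal_sq_le hker hp hw₀ hu (by omega) hw hww hwp hwN hx
      rw [heq]
      rfl
  · rintro _ ⟨x, ⟨hxQ, hxO⟩, rfl⟩
    obtain ⟨r, hr, hxr, hrx⟩ := hrepr x
    have hrr : F r r = 0 := by
      have h2 : q x.rep = 0 := hxQ
      rw [← hrx, hqF] at h2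
      exact (mul_eq_zero.1 h2).resolve_left hc
    have hrm : r ∈ IsLocalRing.maximalIdeal R := by
      by_contra hrm
      obtain ⟨t, ht, a, ha, hra⟩ := h.exists_eq_smul_nilExp hrk hrm hrr
      refine hxO ?_
      rw [hO, horbit 1 h1, hxr]
      refine ⟨a, ha, hne h1 ha, ?_⟩
      rw [Projectivization.mk_eq_mk_iff']
      exact ⟨t, by rw [one_mul, ← map_smul, ← hra]⟩
    rw [hxr, hdim, Nat.cast_le]
    exact Submodule.finrank_mono (hle r hrm)

end Boundary

/-! ### Algebraic families of automorphisms of projective space are linear -/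

section LinearLift

/-- A factor of a nonzero homogeneous polynomial is homogeneous. -/
theorem isHomogeneous_of_mul {σ A : Type*} [CommRing A] [IsDomain A] {h t : MvPolynomial σ A}
    {d : ℕ} (hd : (h * t).IsHomogeneous d) (h0 : h * t ≠ 0) :
    ∃ k l, k + l = d ∧ h.IsHomogeneous k ∧ t.IsHomogeneous l := by
  classical
  -- `Φ` substitutes `X i ↦ X i * T`, so it separates homogeneous components by powers of `T`. Top
  -- and lowest degrees in `T` are additive, hence both factors of a monomial in `T` are monomials
  -- in `T`.
  set Φ : MvPolynomial σ A →ₐ[A] Polynomial (MvPolynomial σ A) :=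
    MvPolynomial.aeval fun i => Polynomial.C (MvPolynomial.X i) * Polynomial.X with hΦ
  have hmon : ∀ (e : σ →₀ ℕ) (a : A), Φ (MvPolynomial.monomial e a) =
      Polynomial.monomial e.degree (MvPolynomial.monomial e a) := by
    intro e a
    rw [hΦ, MvPolynomial.aeval_monomial, MvPolynomial.monomial_eq,
      ← Polynomial.C_mul_X_pow_eq_monomial]
    simp only [mul_pow, map_mul, Finsupp.prod, map_prod, map_pow]
    rw [Finset.prod_mul_distrib, Finset.prod_pow_eq_pow_sum, Finsupp.degree_apply, mul_assoc]
    rfl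
  have hcoeff : ∀ (f : MvPolynomial σ A) (e : σ →₀ ℕ),
      MvPolynomial.coeff e ((Φ f).coeff e.degree) = MvPolynomial.coeff e f := by
    intro f e
    induction f using MvPolynomial.induction_on' with
    | monomial e' a =>
      rw [hmon, Polynomial.coeff_monomial]
      split_ifs with h1
      · rfl
      · rw [MvPolynomial.coeff_monomial, if_neg (fun h2 => h1 (by rw [h2])),
          MvPolynomial.coeff_zero]
    | add p q hp hq => simp [hp, hq]
  have hΦP : Φ h * Φ t = Polynomial.monomial d (h * t) := by
    rw [← map_mul]
    conv_lhs => rw [(h * t).as_sum]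
    conv_rhs => rw [(h * t).as_sum]
    rw [map_sum, map_sum]
    refine Finset.sum_congr rfl fun e he => ?_
    rw [hmon]
    congr 1
    by_contra hne
    exact MvPolynomial.mem_support_iff.1 he (hd.coeff_eq_zero fun h1 => hne (by rw [h1]))
  have hh : Φ h ≠ 0 := fun hz => h0 (by
    rw [hz, zero_mul, eq_comm, Polynomial.monomial_eq_zero_iff] at hΦP
    exact hΦP)
  have ht : Φ t ≠ 0 := fun hz => h0 (by
    rw [hz, mul_zero, eq_comm, Polynomial.monomial_eq_zero_iff] at hΦP
    exact hΦP)
  have h1 := Polynomial.natDegree_mul hh ht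
  have h2 := Polynomial.natTrailingDegree_mul hh ht
  rw [hΦP, Polynomial.natDegree_monomial_eq _ h0] at h1
  rw [hΦP, Polynomial.natTrailingDegree_monomial h0] at h2
  have h3 := (Φ h).natTrailingDegree_le_natDegree
  have h4 := (Φ t).natTrailingDegree_le_natDegree
  have key : ∀ f, (Φ f).natTrailingDegree = (Φ f).natDegree →
      f.IsHomogeneous (Φ f).natDegree := by
    intro f hf e he
    have hw : Finsupp.weight 1 e = e.degree := by rw [Finsupp.degree_eq_weight_one]; rfl
    rw [hw]
    have h5 : (Φ f).coeff e.degree ≠ 0 := fun hz => he (by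
      rw [← hcoeff, hz, MvPolynomial.coeff_zero])
    have h6 := Polynomial.le_natDegree_of_ne_zero h5
    have h7 := Polynomial.natTrailingDegree_le_of_ne_zero h5
    omega
  exact ⟨_, _, h1.symm, key h (by omega), key t (by omega)⟩

/-- In a unique factorization domain, a nonzero finite family is a multiple of a primitive one, and
each family proportional to it is a multiple of the primitive one. -/
theorem exists_primitive_family {A ι : Type*} [CommRing A] [IsDomain A]
    [UniqueFactorizationMonoid A] [Fintype ι] {P : ι → A} (hP : P ≠ 0) :
    ∃ (h : A) (T : ι → A), (∀ i, P i = h * T i) ∧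
      ∀ P' : ι → A, (∀ i j, P i * P' j = P j * P' i) → ∃ h', ∀ i, P' i = h' * T i := by
  classical
  let _ : StrongNormalizationMonoid A := UniqueFactorizationMonoid.strongNormalizationMonoid
  let _ : NormalizedGCDMonoid A := UniqueFactorizationMonoid.toNormalizedGCDMonoid A
  obtain ⟨i₀, hi₀⟩ := Function.ne_iff.1 hP
  obtain ⟨T, hT, hT1⟩ := Finset.extract_gcd P (s := Finset.univ) ⟨i₀, Finset.mem_univ _⟩
  set h := Finset.univ.gcd P
  have hPT : ∀ i, P i = h * T i := fun i => hT i (Finset.mem_univ _)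
  refine ⟨h, T, hPT, fun P' hP' => ?_⟩
  have hne : h ≠ 0 ∧ T i₀ ≠ 0 := by
    rw [Pi.zero_apply, hPT i₀] at hi₀
    exact mul_ne_zero_iff.1 hi₀
  have hTP : ∀ i j, T i * P' j = T j * P' i := by
    intro i j
    have := hP' i j
    rw [hPT, hPT, mul_assoc, mul_assoc] at this
    exact mul_left_cancel₀ hne.1 this
  obtain ⟨c, hc⟩ : T i₀ ∣ P' i₀ := by
    -- `T i₀` divides every `P' i₀ * T i`, hence also their gcd, which is associated to `P' i₀`
    -- since the `T i` have gcd one.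
    have h1 : T i₀ ∣ Finset.univ.gcd fun i => P' i₀ * T i :=
      Finset.dvd_gcd fun i _ => ⟨P' i, by rw [hTP]; ring⟩
    have h2 := (Finset.gcd_mul_left' Finset.univ T (P' i₀)).dvd
    rw [hT1, mul_one] at h2
    exact h1.trans h2
  refine ⟨c, fun i => mul_left_cancel₀ hne.2 ?_⟩
  rw [hTP, hc]; ring

theorem isHomogeneous_one_eq_sum {σ A : Type*} [Fintype σ] [CommRing A] {p : MvPolynomial σ A}
    (hp : p.IsHomogeneous 1) :
    p = ∑ j, MvPolynomial.C (p.coeff (Finsupp.single j 1)) * MvPolynomial.X j := by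
  classical
  ext d
  simp only [MvPolynomial.coeff_sum, MvPolynomial.coeff_C_mul, MvPolynomial.coeff_X]
  by_cases hd : d.degree = 1
  · obtain ⟨j, rfl⟩ : d ∈ Set.range fun a : σ => Finsupp.single a 1 := by
      rw [Finsupp.range_single_one]; exact hd
    rw [Finset.sum_eq_single j]
    · simp
    · intro i _ hij
      rw [if_neg, mul_zero]
      intro h1
      exact hij ((Finsupp.single_left_inj one_ne_zero).1 h1)
    · simp
  · rw [hp.coeff_eq_zero hd, Finset.sum_eq_zero]
    intro j _
    rw [if_neg, mul_zero]
    rintro rfl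
    simp at hd

variable {K : Type u} [Field K]

theorem eval₂_eval_ext [Infinite K] {σ τ : Type*} {p q : MvPolynomial σ (MvPolynomial τ K)}
    (h : ∀ g v, MvPolynomial.eval₂ (MvPolynomial.eval g) v p =
      MvPolynomial.eval₂ (MvPolynomial.eval g) v q) : p = q := by
  ext1 d
  refine MvPolynomial.funext fun g => ?_
  rw [← MvPolynomial.coeff_map, ← MvPolynomial.coeff_map]
  congr 1
  refine MvPolynomial.funext fun v => ?_
  rw [MvPolynomial.eval_map, MvPolynomial.eval_map]
  exact h g v

/-- A polynomial function on the affine line over an algebraically closed field without zeros is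
constant. -/
theorem eval_eq_eval_of_forall_ne_zero [IsAlgClosed K] {p : Polynomial K}
    (hp : ∀ t, p.eval t ≠ 0) (s t : K) : p.eval s = p.eval t := by
  have h1 : p.degree = 0 := by
    by_contra hd
    obtain ⟨x, hx⟩ := IsAlgClosed.exists_root p hd
    exact hp x hx
  rw [Polynomial.eq_C_of_degree_eq_zero h1]
  simp

/-- A homogeneous polynomial in at least two variables without nontrivial zeros is constant. -/
theorem degree_eq_zero_of_forall_eval_ne_zero [IsAlgClosed K] [CharZero K] {m k : ℕ}
    {H : MvPolynomial (Fin (m + 1 + 1)) K} (hH : H.IsHomogeneous k)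
    (h0 : ∀ v, v ≠ 0 → MvPolynomial.eval v H ≠ 0) : k = 0 := by
  set e : K → K → Fin (m + 1 + 1) → K := fun a b => Pi.single 0 a + Pi.single 1 b with he
  have hne : ∀ a b, a ≠ 0 ∨ b ≠ 0 → e a b ≠ 0 := by
    intro a b hab h1
    have h2 := congrFun h1 0
    have h3 := congrFun h1 1
    simp [he] at h2 h3
    tauto
  have hpoly : ∀ a b c d : K, ∃ p : Polynomial K, ∀ t,
      p.eval t = MvPolynomial.eval (e (a + t * b) (c + t * d)) H := by
    intro a b c d
    refine ⟨MvPolynomial.aeval (fun i => Polynomial.C (e a c i) +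
      Polynomial.X * Polynomial.C (e b d i)) H, fun t => ?_⟩
    rw [← Polynomial.coe_evalRingHom, MvPolynomial.aeval_def, MvPolynomial.hom_eval₂,
      MvPolynomial.eval, MvPolynomial.coe_eval₂Hom]
    congr 1
    · ext; simp
    · funext i
      simp [he, Pi.single_apply]
      split_ifs <;> ring
  have h1 : ∀ t, MvPolynomial.eval (e 1 t) H = MvPolynomial.eval (e 1 0) H := by
    intro t
    obtain ⟨p, hp⟩ := hpoly 1 0 0 1
    have := eval_eq_eval_of_forall_ne_zero (p := p)
      (fun t => by rw [hp]; exact h0 _ (hne _ _ (Or.inl (by simp)))) t 0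
    simpa [hp] using this
  have h2 : ∀ t, MvPolynomial.eval (e t 1) H = MvPolynomial.eval (e 0 1) H := by
    intro t
    obtain ⟨p, hp⟩ := hpoly 0 1 1 0
    have := eval_eq_eval_of_forall_ne_zero (p := p)
      (fun t => by rw [hp]; exact h0 _ (hne _ _ (Or.inr (by simp)))) t 0
    simpa [hp] using this
  -- `H` is constant on each of the lines `(1, t)` and `(t, 1)`, with a common value at `(1, 1)`.
  -- Comparing the proportional points `(1, 2)` and `(1/2, 1)` yields `2 ^ k = 1`.
  have h3 : e 1 2 = (2 : K) • e (1 / 2) 1 := by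
    funext i
    simp only [he, Pi.add_apply, Pi.single_apply, Pi.smul_apply, smul_eq_mul, mul_add, mul_ite]
    simp
  have h4 := h1 2
  rw [h3, eval_smul_of_isHomogeneous hH, h2, ← h2 1, h1 1] at h4
  have h5 := h0 (e 1 0) (hne _ _ (by simp))
  have h6 : (2 : K) ^ k = 1 := mul_right_cancel₀ h5 (by rw [h4, one_mul])
  by_contra hk
  have h7 : (2 : ℕ) ^ k = 1 := by exact_mod_cast h6
  exact (Nat.one_lt_two_pow hk).ne' h7

end LinearLift

section LinearLift

variable {K : Type u} [Field K] [IsAlgClosed K] [CharZero K]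

/-- A polynomial family of polynomial vector fields, tangent to all lines through the origin for
`g = 0`, without zeros outside the origin and homogeneous, is a family of linear maps. -/
theorem isHomogeneous_one_of_forall_smul {n m e : ℕ}
    {T : Fin (m + 1 + 1) → MvPolynomial (Fin (m + 1 + 1)) (MvPolynomial (Fin n) K)}
    (hT : ∀ i, (T i).IsHomogeneous e) (hT0 : ∀ v, v ≠ 0 → tupleEval T 0 v ≠ 0)
    (hTv : ∀ v i j, v i * tupleEval T 0 v j = v j * tupleEval T 0 v i) :
    e = 1 ∧ ∃ c : K, c ≠ 0 ∧ ∀ v, tupleEval T 0 v = c • v := by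
  set P : Fin (m + 1 + 1) → MvPolynomial (Fin (m + 1 + 1)) K :=
    fun i => MvPolynomial.map (MvPolynomial.eval 0) (T i) with hP
  have hev : ∀ v i, MvPolynomial.eval v (P i) = tupleEval T 0 v i := fun v i => by
    rw [hP, MvPolynomial.eval_map]; rfl
  have hPX : ∀ i j, MvPolynomial.X i * P j = MvPolynomial.X j * P i := by
    intro i j
    refine MvPolynomial.funext fun v => ?_
    rw [map_mul, map_mul, MvPolynomial.eval_X, MvPolynomial.eval_X, hev, hev, hTv]
  -- A field tangent to all lines through the origin is `H` times the Euler field. Having no zeros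
  -- off the origin, `H` is constant, and this forces degree one.
  obtain ⟨H, hH⟩ : ∃ H, ∀ i, P i = MvPolynomial.X i * H := by
    obtain ⟨H, hH⟩ : (MvPolynomial.X 0 : MvPolynomial (Fin (m + 1 + 1)) K) ∣ P 0 := by
      have h1 : (MvPolynomial.X 0 : MvPolynomial (Fin (m + 1 + 1)) K) ∣ MvPolynomial.X 1 * P 0 :=
        ⟨P 1, hPX 1 0⟩
      refine ((MvPolynomial.X_prime).dvd_or_dvd h1).resolve_left fun h2 => ?_
      rw [MvPolynomial.X_dvd_X] at h2
      simp at h2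
    refine ⟨H, fun i => mul_left_cancel₀ (MvPolynomial.X_ne_zero 0) ?_⟩
    rw [hPX, hH]; ring
  have hH0 : ∀ v, v ≠ 0 → MvPolynomial.eval v H ≠ 0 := by
    intro v hv h0
    refine hT0 v hv (funext fun i => ?_)
    rw [← hev, hH, map_mul, h0, mul_zero]; rfl
  have hH1 : H ≠ 0 := by
    rintro rfl
    refine hH0 (Pi.single 0 1) (fun h1 => ?_) (map_zero _)
    simpa using congrFun h1 0
  have hX : (MvPolynomial.X 0 * H : MvPolynomial (Fin (m + 1 + 1)) K) ≠ 0 :=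
    mul_ne_zero (MvPolynomial.X_ne_zero 0) hH1
  have hPe : (MvPolynomial.X 0 * H).IsHomogeneous e := by
    rw [← hH]; exact (hT 0).map _
  obtain ⟨k, l, hkl, hk, hl⟩ := isHomogeneous_of_mul hPe hX
  have hl0 := degree_eq_zero_of_forall_eval_ne_zero hl hH0
  subst hl0
  have hk1 := hk.inj_right (MvPolynomial.isHomogeneous_X K 0) (MvPolynomial.X_ne_zero 0)
  have hHC := MvPolynomial.totalDegree_eq_zero_iff_eq_C.1 (hl.totalDegree hH1)
  refine ⟨by omega, MvPolynomial.coeff 0 H, ?_, fun v => ?_⟩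
  · intro h0
    exact hH1 (by rw [hHC, h0, map_zero])
  · funext i
    rw [← hev, hH, map_mul, MvPolynomial.eval_X, hHC, MvPolynomial.eval_C,
      MvPolynomial.coeff_zero_C, Pi.smul_apply, smul_eq_mul, mul_comm]

/-- An algebraic action of the additive group on projective space is given by matrices with
polynomial entries. -/
theorem exists_matrix_of_isMorphism {n m : ℕ}
    {a : (Fin n → K) → Proj K (m + 1) → Proj K (m + 1)} (ha : IsMorphism a)
    (ha0 : ∀ x, a 0 x = x) :
    ∃ M : Matrix (Fin (m + 1 + 1)) (Fin (m + 1 + 1)) (MvPolynomial (Fin n) K),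
      M.map (MvPolynomial.eval 0) = 1 ∧
      ∀ (g : Fin n → K) (v : Fin (m + 1 + 1) → K) (hv : v ≠ 0),
        ∃ h : (M.map (MvPolynomial.eval g)).mulVec v ≠ 0,
        a g (Projectivization.mk K v hv) =
          Projectivization.mk K ((M.map (MvPolynomial.eval g)).mulVec v) h := by
  have hsm : ∀ {d : ℕ} {P : Fin (m + 1 + 1) →
      MvPolynomial (Fin (m + 1 + 1)) (MvPolynomial (Fin n) K)}, (∀ i, (P i).IsHomogeneous d) →
      ∀ g (c : K) v, tupleEval P g (c • v) = c ^ d • tupleEval P g v := fun hP g c v => by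
    funext i
    rw [Pi.smul_apply, smul_eq_mul, tupleEval, tupleEval]
    exact eval₂_smul_of_isHomogeneous (MvPolynomial.eval g) (hP i) c v
  set v₀ : Fin (m + 1 + 1) → K := Pi.single 0 1 with hv₀
  have hv₀0 : v₀ ≠ 0 := fun h1 => by simpa [hv₀] using congrFun h1 0
  obtain ⟨d, P, hP, hP0, hPa⟩ := ha 0 (Projectivization.mk K v₀ hv₀0)
  have hPne : P ≠ 0 := by
    rintro rfl
    refine hP0 (funext fun i => ?_)
    simp [tupleEval]
  -- The primitive part of one local presentation works globally: any other presentation is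
  -- proportional to it, hence a polynomial multiple of `T`, so `T` cannot vanish where the other
  -- one does not.
  obtain ⟨h, T, hPT, hprim⟩ := exists_primitive_family hPne
  have hev : ∀ {h' : MvPolynomial (Fin (m + 1 + 1)) (MvPolynomial (Fin n) K)} {P' : Fin (m + 1 + 1) →
      MvPolynomial (Fin (m + 1 + 1)) (MvPolynomial (Fin n) K)}, (∀ i, P' i = h' * T i) →
      ∀ g v, tupleEval P' g v = MvPolynomial.eval₂ (MvPolynomial.eval g) v h' • tupleEval T g v := by
    intro h' P' hP' g v
    funext i
    rw [tupleEval, hP', MvPolynomial.eval₂_mul]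
    rfl
  have hTe : ∃ e, ∀ i, (T i).IsHomogeneous e := by
    have key : ∀ i, T i ≠ 0 → ∃ k l, k + l = d ∧ h.IsHomogeneous k ∧ (T i).IsHomogeneous l := by
      intro i hi
      refine isHomogeneous_of_mul (hPT i ▸ hP i) (mul_ne_zero ?_ hi)
      rintro rfl
      exact hPne (funext fun i => by rw [hPT, zero_mul]; rfl)
    obtain ⟨i₀, hi₀⟩ := Function.ne_iff.1 hPne
    rw [hPT, Pi.zero_apply, mul_ne_zero_iff] at hi₀
    obtain ⟨k, l, hkl, hk, hl⟩ := key i₀ hi₀.2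
    refine ⟨l, fun i => ?_⟩
    by_cases hi : T i = 0
    · rw [hi]; exact MvPolynomial.isHomogeneous_zero _ _ _
    · obtain ⟨k', l', hkl', hk', hl'⟩ := key i hi
      have := hk.inj_right hk' hi₀.1
      rwa [show l = l' by omega]
  obtain ⟨e, he⟩ := hTe
  have hrep : ∀ (g : Fin n → K) (v : Fin (m + 1 + 1) → K) (hv : v ≠ 0),
      ∃ hT : tupleEval T g v ≠ 0,
        a g (Projectivization.mk K v hv) = Projectivization.mk K (tupleEval T g v) hT := by
    intro g v hv
    obtain ⟨d', P', hP', hP0', hPa'⟩ := ha g (Projectivization.mk K v hv)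
    obtain ⟨c, hc⟩ := Projectivization.exists_smul_eq_mk_rep K v hv
    rw [← hc, Units.smul_def, hsm hP'] at hP0'
    have hP'v := (smul_ne_zero_iff.1 hP0').2
    obtain ⟨h', hh'⟩ := hprim P' (fun i j => by
      -- The factor `X 0` makes the identity trivial at the zero vector, where there is no
      -- projective point to compare.
      refine mul_left_cancel₀ (MvPolynomial.X_ne_zero (0 : Fin (m + 1 + 1))) ?_
      refine eval₂_eval_ext fun g u => ?_
      simp only [MvPolynomial.eval₂_mul, MvPolynomial.eval₂_X]
      by_cases hu : u = 0
      · rw [hu]; simp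
      congr 1
      change tupleEval P g u i * tupleEval P' g u j = tupleEval P g u j * tupleEval P' g u i
      by_cases h1 : tupleEval P g u = 0
      · rw [h1]; simp
      by_cases h2 : tupleEval P' g u = 0
      · rw [h2]; simp
      have h3 := (hPa g u hu h1).symm.trans (hPa' g u hu h2)
      obtain ⟨t, ht⟩ := (Projectivization.mk_eq_mk_iff' K _ _ _ _).1 h3
      rw [← ht]
      simp only [Pi.smul_apply, smul_eq_mul]
      ring)
    have h4 := hev hh' g v
    have h5 : tupleEval T g v ≠ 0 := by
      intro h0
      rw [h0, smul_zero] at h4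
      exact hP'v h4
    refine ⟨h5, ?_⟩
    rw [hPa' g v hv hP'v, Projectivization.mk_eq_mk_iff']
    exact ⟨_, h4.symm⟩
  obtain ⟨rfl, c, hc, hcv⟩ := isHomogeneous_one_of_forall_smul he
    (fun v hv => (hrep 0 v hv).1) (fun v i j => by
      by_cases hv : v = 0
      · rw [hv]; simp
      obtain ⟨h1, h2⟩ := hrep 0 v hv
      rw [ha0, Projectivization.mk_eq_mk_iff'] at h2
      obtain ⟨t, ht⟩ := h2
      generalize tupleEval T 0 v = x at ht
      rw [← ht]
      simp only [Pi.smul_apply, smul_eq_mul]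
      ring)
  set M : Matrix (Fin (m + 1 + 1)) (Fin (m + 1 + 1)) (MvPolynomial (Fin n) K) :=
    Matrix.of fun i j => MvPolynomial.C c⁻¹ * (T i).coeff (Finsupp.single j 1) with hM
  have hMv : ∀ g v, (M.map (MvPolynomial.eval g)).mulVec v = c⁻¹ • tupleEval T g v := by
    intro g v
    funext i
    rw [Pi.smul_apply, tupleEval, isHomogeneous_one_eq_sum (he i)]
    simp only [MvPolynomial.eval₂_sum, MvPolynomial.eval₂_mul, MvPolynomial.eval₂_C,
      MvPolynomial.eval₂_X, Matrix.mulVec, dotProduct, Matrix.map_apply, hM, Matrix.of_apply,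
      map_mul, MvPolynomial.eval_C, smul_eq_mul, Finset.mul_sum]
    refine Finset.sum_congr rfl fun j _ => ?_
    ring
  refine ⟨M, ?_, fun g v hv => ?_⟩
  · refine Matrix.ext_of_mulVec_single fun j => ?_
    rw [hMv, hcv, smul_smul, inv_mul_cancel₀ hc, one_smul, Matrix.one_mulVec]
  · obtain ⟨h1, h2⟩ := hrep g v hv
    refine ⟨by rw [hMv]; exact smul_ne_zero (inv_ne_zero hc) h1, ?_⟩
    rw [h2, Projectivization.mk_eq_mk_iff']
    exact ⟨c, by rw [hMv, smul_smul, mul_inv_cancel₀ hc, one_smul]⟩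

end LinearLift

/-! ### Polynomial representations of vector groups -/

section Representation

variable {K : Type u} [Field K] {ι : Type}

/-- A map from a vector space to matrices is polynomial along each line through the origin. -/
def PolynomialOnRays {G : Type*} [SMul K G] (ρ : G → Matrix ι ι K) : Prop :=
  ∀ g, ∃ P : Matrix ι ι (Polynomial K), ∀ t : K, P.map (Polynomial.eval t) = ρ (t • g)

theorem matrix_polynomial_ext [Infinite K] {P Q : Matrix ι ι (Polynomial K)}
    (h : ∀ t, P.map (Polynomial.eval t) = Q.map (Polynomial.eval t)) : P = Q := by
  ext1 i j
  exact Polynomial.funext fun t => congrFun (congrFun (h t) i) j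

theorem matrix_map_C_map_eval (A : Matrix ι ι K) (t : K) :
    (A.map Polynomial.C).map (Polynomial.eval t) = A := by
  ext i j; simp

variable [Fintype ι]

theorem matrix_map_eval_mul (P Q : Matrix ι ι (Polynomial K)) (t : K) :
    (P * Q).map (Polynomial.eval t) = P.map (Polynomial.eval t) * Q.map (Polynomial.eval t) :=
  Matrix.map_mul (f := Polynomial.evalRingHom t)

theorem matrix_coeff_C_mul (A : Matrix ι ι K) (P : Matrix ι ι (Polynomial K)) (k : ℕ) :
    (A.map Polynomial.C * P).map (fun p => p.coeff k) = A * P.map fun p => p.coeff k := by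
  ext i j
  simp [Matrix.mul_apply, Polynomial.finsetSum_coeff]

theorem matrix_coeff_mul_C (A : Matrix ι ι K) (P : Matrix ι ι (Polynomial K)) (k : ℕ) :
    (P * A.map Polynomial.C).map (fun p => p.coeff k) = P.map (fun p => p.coeff k) * A := by
  ext i j
  simp [Matrix.mul_apply, Polynomial.finsetSum_coeff]

variable [DecidableEq ι] {G : Type*} [AddCommGroup G] [Module K G] {ρ : G → Matrix ι ι K}

/-- A projective representation by polynomial families of matrices is a representation. -/
theorem map_add_of_projective [IsAlgClosed K] [CharZero K] [Nonempty ι]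
    (hpoly : PolynomialOnRays ρ) (h0 : ρ 0 = 1)
    (hinj : ∀ g v, v ≠ 0 → (ρ g).mulVec v ≠ 0)
    (hproj : ∀ g h v, ∃ c : K, c • (ρ (g + h)).mulVec v = (ρ g).mulVec ((ρ h).mulVec v))
    (g h : G) : ρ (g + h) = ρ g * ρ h := by
  have hdet0 : ∀ g, (ρ g).det ≠ 0 := fun g hg => by
    obtain ⟨v, hv, hv0⟩ := Matrix.exists_mulVec_eq_zero_iff.2 hg
    exact hinj g v hv hv0
  have hdet : ∀ g, (ρ g).det = 1 := by
    intro g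
    obtain ⟨P, hP⟩ := hpoly g
    have h1 : ∀ t, P.det.eval t = (ρ (t • g)).det := fun t => by
      rw [← hP, ← Polynomial.coe_evalRingHom, RingHom.map_det]; rfl
    have h2 := eval_eq_eval_of_forall_ne_zero (p := P.det)
      (fun t => by rw [h1]; exact hdet0 _) 1 0
    rw [h1, h1, one_smul, zero_smul, h0, Matrix.det_one] at h2
    exact h2
  -- Every vector is an eigenvector of `ρ(g+h)⁻¹ ρ(g) ρ(h)`, which is therefore scalar.
  have hlam : ∀ g h, ∃ c : K, ρ g * ρ h = c • ρ (g + h) := by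
    intro g h
    have hu : IsUnit (ρ (g + h)).det := by rw [hdet]; exact isUnit_one
    have h1 : ∀ v, ¬ LinearIndependent K ![v, Matrix.mulVecLin ((ρ (g + h))⁻¹ * (ρ g * ρ h)) v] := by
      intro v hli
      obtain ⟨c, hc⟩ := hproj g h v
      rw [LinearIndependent.pair_iff] at hli
      have h2 : Matrix.mulVecLin ((ρ (g + h))⁻¹ * (ρ g * ρ h)) v = c • v := by
        rw [Matrix.mulVecLin_apply, ← Matrix.mulVec_mulVec, ← Matrix.mulVec_mulVec, ← hc,
          Matrix.mulVec_smul, Matrix.mulVec_mulVec, Matrix.nonsing_inv_mul _ hu, Matrix.one_mulVec]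
      have := (hli (-c) 1 (by rw [h2]; simp)).2
      exact one_ne_zero this
    obtain ⟨c, hc⟩ := LinearMap.exists_eq_smul_id_of_forall_notLinearIndependent h1
    have h3 : (ρ (g + h))⁻¹ * (ρ g * ρ h) = c • 1 := by
      refine Matrix.ext_of_mulVec_single fun j => ?_
      have := LinearMap.congr_fun hc (Pi.single j 1)
      rw [Matrix.mulVecLin_apply] at this
      rw [this, Matrix.smul_mulVec, Matrix.one_mulVec]
      rfl
    refine ⟨c, ?_⟩
    rw [← one_mul (ρ g * ρ h), ← Matrix.mul_nonsing_inv _ hu, Matrix.mul_assoc, h3,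
      Matrix.mul_smul, Matrix.mul_one]
  choose c hc using hlam
  have hcpow : ∀ g h, c g h ^ Fintype.card ι = 1 := by
    intro g h
    have := congrArg Matrix.det (hc g h)
    rw [Matrix.det_mul, Matrix.det_smul, hdet, hdet, hdet, mul_one, mul_one] at this
    exact this.symm
  obtain ⟨P, hP⟩ := hpoly g
  obtain ⟨Q, hQ⟩ := hpoly h
  obtain ⟨S, hS⟩ := hpoly (g + h)
  obtain ⟨i⟩ := ‹Nonempty ι›
  -- Along `(t g, t h)` the scalar is a polynomial in `t`. As all determinants are one it is a root
  -- of unity, so it never vanishes and keeps its value `1` from `t = 0`.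
  have hcp : ∀ t, ((P * Q * S.adjugate) i i).eval t = c (t • g) (t • h) := by
    intro t
    have h1 : (P * Q * S.adjugate).map (Polynomial.eval t) = c (t • g) (t • h) • 1 := by
      have h2 : S.adjugate.map (Polynomial.eval t) = (S.map (Polynomial.eval t)).adjugate :=
        RingHom.map_adjugate (Polynomial.evalRingHom t) S
      rw [matrix_map_eval_mul, matrix_map_eval_mul, h2, hP, hQ, hS, hc, smul_add, Matrix.smul_mul,
        Matrix.mul_adjugate, hdet, one_smul]
    have := congrFun (congrFun h1 i) i
    simpa using this
  have h1 := eval_eq_eval_of_forall_ne_zero (p := (P * Q * S.adjugate) i i) (fun t => by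
    rw [hcp]
    intro hz
    have := hcpow (t • g) (t • h)
    rw [hz, zero_pow Fintype.card_ne_zero] at this
    exact zero_ne_one this) 1 0
  rw [hcp, hcp, one_smul, one_smul, zero_smul, zero_smul] at h1
  have h2 : c (0 : G) 0 = 1 := by
    have h3 := hc 0 0
    rw [add_zero, h0, Matrix.one_mul] at h3
    have := congrFun (congrFun h3 i) i
    simpa using this.symm
  rw [hc, h1, h2, one_smul]

/-- A polynomial representation of a vector group is the exponential of a linear map with values in
commuting nilpotent matrices. -/
theorem exists_linearMap_exp [CharZero K] (hpoly : PolynomialOnRays ρ) (h0 : ρ 0 = 1)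
    (hadd : ∀ g h, ρ (g + h) = ρ g * ρ h) :
    ∃ N : G →ₗ[K] Matrix ι ι K, (∀ g h, N g * N h = N h * N g) ∧
      ∀ g, ∃ D : ℕ, N g ^ D = 0 ∧
        ρ g = ∑ k ∈ Finset.range D, ((k.factorial : K)⁻¹) • N g ^ k := by
  choose P hP using hpoly
  have hcoeff0 : ∀ g, (P g).map (fun p => p.coeff 0) = 1 := fun g => by
    have := hP g 0
    rw [zero_smul, h0] at this
    rw [← this]
    ext i j
    simp [Polynomial.coeff_zero_eq_eval_zero]
  have hmul1 : ∀ A B : Matrix ι ι (Polynomial K), (A * B).map (fun p => p.coeff 1) =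
      A.map (fun p => p.coeff 0) * B.map (fun p => p.coeff 1) +
        A.map (fun p => p.coeff 1) * B.map (fun p => p.coeff 0) := fun A B => by
    ext i j
    simp [Matrix.mul_apply, Polynomial.finsetSum_coeff, Polynomial.mul_coeff_one,
      Finset.sum_add_distrib]
  -- `N g` is the derivative at `t = 0` of the polynomial `t ↦ ρ (t • g)`.
  let N : G →ₗ[K] Matrix ι ι K :=
    { toFun := fun g => (P g).map fun p => p.coeff 1
      map_add' := fun g h => by
        have h1 : P (g + h) = P g * P h := matrix_polynomial_ext fun t => by
          rw [matrix_map_eval_mul, hP, hP, hP, smul_add, hadd]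
        rw [h1, hmul1, hcoeff0, hcoeff0, Matrix.one_mul, Matrix.mul_one, add_comm]
      map_smul' := fun c g => by
        have h1 : P (c • g) = (P g).map fun p => p.comp (Polynomial.C c * Polynomial.X) :=
          matrix_polynomial_ext fun t => by
            rw [hP, smul_smul, ← hP]
            ext i j
            simp only [Matrix.map_apply, Polynomial.eval_comp, Polynomial.eval_mul,
              Polynomial.eval_C, Polynomial.eval_X]
            rw [mul_comm]
        rw [h1]
        ext i j
        simp only [Matrix.map_apply, RingHom.id_apply, Matrix.smul_apply, smul_eq_mul,
          Polynomial.comp_C_mul_X_coeff, pow_one]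
        ring }
  have hN : ∀ g, N g = (P g).map fun p => p.coeff 1 := fun g => rfl
  have hcomm : ∀ g h, ρ g * ρ h = ρ h * ρ g := fun g h => by rw [← hadd, ← hadd, add_comm]
  have hNρ : ∀ g h, N g * ρ h = ρ h * N g := by
    intro g h
    have h1 : P g * (ρ h).map Polynomial.C = (ρ h).map Polynomial.C * P g :=
      matrix_polynomial_ext fun t => by
        rw [matrix_map_eval_mul, matrix_map_eval_mul, hP, matrix_map_C_map_eval, hcomm]
    rw [hN, ← matrix_coeff_mul_C, ← matrix_coeff_C_mul, h1]
  refine ⟨N, fun g h => ?_, fun g => ?_⟩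
  · have h1 : (N g).map Polynomial.C * P h = P h * (N g).map Polynomial.C :=
      matrix_polynomial_ext fun t => by
        rw [matrix_map_eval_mul, matrix_map_eval_mul, hP, matrix_map_C_map_eval, hNρ]
    rw [hN h, ← matrix_coeff_mul_C, ← matrix_coeff_C_mul, h1]
  -- Differentiating `ρ((s+t)g) = ρ(sg) ρ(tg)` at `t = 0` gives `P' = P N`, whose coefficients are
  -- `N ^ k / k!`. They vanish beyond the degree of `P`, so `N g` is nilpotent.
  · have hder : (P g).map Polynomial.derivative = P g * (N g).map Polynomial.C := by
      refine matrix_polynomial_ext fun s => ?_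
      have h1 : (P g).map (Polynomial.taylor s) = (ρ (s • g)).map Polynomial.C * P g :=
        matrix_polynomial_ext fun t => by
          rw [matrix_map_eval_mul, matrix_map_C_map_eval, hP, ← hadd, ← add_smul, ← hP]
          ext i j
          simp [Polynomial.taylor_eval, add_comm]
      have h2 := congrArg (fun A : Matrix ι ι (Polynomial K) => A.map fun p => p.coeff 1) h1
      simp only [matrix_coeff_C_mul] at h2
      rw [matrix_map_eval_mul, matrix_map_C_map_eval, hP, hN, ← h2]
      ext i j
      simp [Polynomial.taylor_coeff_one]
    have hk : ∀ k, (P g).map (fun p => p.coeff k) = ((k.factorial : K)⁻¹) • N g ^ k := by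
      intro k
      induction k with
      | zero => rw [hcoeff0]; simp
      | succ k ih =>
        have h1 := congrArg (fun A : Matrix ι ι (Polynomial K) => A.map fun p => p.coeff k) hder
        simp only [matrix_coeff_mul_C, ih] at h1
        have h2 : ((P g).map Polynomial.derivative).map (fun p => p.coeff k) =
            ((k : K) + 1) • (P g).map fun p => p.coeff (k + 1) := by
          ext i j
          simp [Polynomial.coeff_derivative, mul_comm]
        rw [h2, Matrix.smul_mul, ← pow_succ] at h1
        have h3 : ((k : K) + 1) ≠ 0 := by exact_mod_cast Nat.succ_ne_zero k
        rw [← inv_smul_smul₀ h3 ((P g).map fun p => p.coeff (k + 1)), h1, smul_smul,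
          Nat.factorial_succ]
        push_cast
        rw [mul_inv]
    obtain ⟨D, hD⟩ : ∃ D, ∀ i j, (P g i j).natDegree < D := by
      refine ⟨(Finset.univ.sup fun i => Finset.univ.sup fun j => (P g i j).natDegree) + 1,
        fun i j => Nat.lt_succ_of_le ?_⟩
      exact (Finset.le_sup (f := fun j => (P g i j).natDegree) (Finset.mem_univ j)).trans
        (Finset.le_sup (f := fun i => Finset.univ.sup fun j => (P g i j).natDegree)
          (Finset.mem_univ i))
    refine ⟨D, ?_, ?_⟩
    · have h1 : (P g).map (fun p => p.coeff D) = 0 := by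
        ext i j
        simp [Polynomial.coeff_eq_zero_of_natDegree_lt (hD i j)]
      rw [hk] at h1
      exact (smul_eq_zero.1 h1).resolve_left
        (inv_ne_zero (by exact_mod_cast Nat.factorial_ne_zero D))
    · rw [← one_smul K g, ← hP, one_smul]
      simp only [← hk]
      ext i j
      rw [Matrix.sum_apply, Matrix.map_apply, Polynomial.eval_eq_sum_range' (hD i j)]
      simp

end Representation

/-! ### Quadrics of large rank -/

section Quadric

variable {K : Type u} [Field K] {V : Type*} [AddCommGroup V] [Module K V]
  {q : QuadraticForm K V}

theorem polar_self_eq (x : V) : QuadraticMap.polar q x x = 2 * q x := by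
  rw [QuadraticMap.polar_self, nsmul_eq_mul, Nat.cast_ofNat]

theorem quadraticForm_add_smul (x y : V) (t : K) :
    q (x + t • y) = q x + t * QuadraticMap.polar q x y + t ^ 2 * q y := by
  have h1 : QuadraticMap.polar q x (t • y) = t * QuadraticMap.polar q x y := by
    rw [QuadraticMap.polar_smul_right, smul_eq_mul]
  rw [QuadraticMap.polar, QuadraticMap.map_smul, smul_eq_mul] at h1
  linear_combination h1

theorem quadraticForm_combination (x y z : V) (a b c : K) :
    q (a • x + b • y + c • z) = a ^ 2 * q x + b ^ 2 * q y + c ^ 2 * q z +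
      a * b * QuadraticMap.polar q x y + a * c * QuadraticMap.polar q x z +
      b * c * QuadraticMap.polar q y z := by
  rw [quadraticForm_add_smul, quadraticForm_add_smul, QuadraticMap.polar_add_left,
    QuadraticMap.polar_smul_left, QuadraticMap.polar_smul_left, QuadraticMap.polar_smul_left,
    QuadraticMap.map_smul]
  simp only [smul_eq_mul]
  ring

theorem polar_eq_zero_of_forall [CharZero K] {S : Submodule K V} (h : ∀ x ∈ S, q x = 0) {x y : V}
    (hx : x ∈ S) (hy : y ∈ S) : QuadraticMap.polar q x y = 0 := by
  rw [QuadraticMap.polar, h _ (S.add_mem hx hy), h x hx, h y hy, sub_zero, sub_zero]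

variable [FiniteDimensional K V]

theorem finrank_le_of_functionals_polar (f g : V →ₗ[K] K)
    (h : ∀ c, f c = 0 → g c = 0 → ∀ d, QuadraticMap.polar q c d = 0) :
    Module.finrank K V ≤ Module.finrank K (LinearMap.ker q.polarBilin) + 2 := by
  have := finrank_le_of_functionals (W := ⊤) (N := LinearMap.ker q.polarBilin) f g
    (fun c _ hf hg => mem_ker_bilin_iff.2 (h c hf hg))
  rwa [finrank_top] at this

variable [CharZero K]
  (hq : Module.finrank K (LinearMap.ker q.polarBilin) + 2 < Module.finrank K V)

include hq

/-- `v` and `x` form a hyperbolic pair, so the space is their span plus its orthogonal complement.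
If `q` vanished on the complement, the rank would be two. -/
theorem exists_ne_zero_of_polar_ne_zero {v x : V} (hv : q v = 0) (hx : q x = 0)
    (hvx : QuadraticMap.polar q v x ≠ 0) :
    ∃ z, QuadraticMap.polar q v z = 0 ∧ QuadraticMap.polar q x z = 0 ∧ q z ≠ 0 := by
  by_contra! hcon
  set S : Submodule K V := LinearMap.ker (q.polarBilin v) ⊓ LinearMap.ker (q.polarBilin x) with hS
  have hS0 : ∀ z ∈ S, q z = 0 := fun z hz => hcon z hz.1 hz.2
  refine absurd (finrank_le_of_functionals_polar (q := q) (q.polarBilin v) (q.polarBilin x) ?_)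
    (by omega)
  intro c hc1 hc2 d
  set a := QuadraticMap.polar q x d / QuadraticMap.polar q v x with ha
  set b := QuadraticMap.polar q v d / QuadraticMap.polar q v x with hb
  have hvv : QuadraticMap.polar q v v = 0 := by rw [polar_self_eq, hv, mul_zero]
  have hxx : QuadraticMap.polar q x x = 0 := by rw [polar_self_eq, hx, mul_zero]
  have hd : d - a • v - b • x ∈ S := by
    constructor
    · change QuadraticMap.polar q v (d - a • v - b • x) = 0
      rw [QuadraticMap.polar_sub_right, QuadraticMap.polar_sub_right,
        QuadraticMap.polar_smul_right, QuadraticMap.polar_smul_right, hvv, smul_eq_mul,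
        smul_eq_mul, hb, div_mul_cancel₀ _ hvx]
      ring
    · change QuadraticMap.polar q x (d - a • v - b • x) = 0
      rw [QuadraticMap.polar_sub_right, QuadraticMap.polar_sub_right,
        QuadraticMap.polar_smul_right, QuadraticMap.polar_smul_right, hxx, smul_eq_mul,
        smul_eq_mul, QuadraticMap.polar_comm q x v, ha, div_mul_cancel₀ _ hvx]
      ring
  have h1 := polar_eq_zero_of_forall hS0 (show c ∈ S from ⟨hc1, hc2⟩) hd
  have hc1' : QuadraticMap.polar q v c = 0 := hc1
  have hc2' : QuadraticMap.polar q x c = 0 := hc2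
  rw [QuadraticMap.polar_sub_right, QuadraticMap.polar_sub_right, QuadraticMap.polar_smul_right,
    QuadraticMap.polar_smul_right, QuadraticMap.polar_comm q c v, QuadraticMap.polar_comm q c x,
    hc1', hc2', smul_zero, smul_zero, sub_zero, sub_zero] at h1
  exact h1

/-- Two isotropic vectors are joined, up to a scalar, by a polynomial curve of isotropic vectors. -/
theorem exists_isotropic_curve {v x : V} (hv : q v = 0) (hx : q x = 0) :
    ∃ (z : V) (b : K) (p₁ p₂ p₃ : Polynomial K), b ≠ 0 ∧
      (∀ t, q (p₁.eval t • v + p₂.eval t • x + p₃.eval t • z) = 0) ∧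
      p₁.eval 0 = 1 ∧ p₂.eval 0 = 0 ∧ p₃.eval 0 = 0 ∧
      p₁.eval 1 = 0 ∧ p₂.eval 1 = b ∧ p₃.eval 1 = 0 := by
  by_cases hvx : QuadraticMap.polar q v x = 0
  · refine ⟨0, 1, 1 - Polynomial.X, Polynomial.X, 0, one_ne_zero, fun t => ?_, ?_⟩
    · rw [quadraticForm_combination, hv, hx, hvx]
      simp
    · simp
  · obtain ⟨z, hvz, hxz, hz⟩ := exists_ne_zero_of_polar_ne_zero hq hv hx hvx
    -- A conic in the span of `v`, `x`, `z`: on `(1-t)² v + b t² x + t(1-t) z` the form `q` is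
    -- `t²(1-t)²` times `b * polar v x + q z`, which determines `b`.
    refine ⟨z, -q z / QuadraticMap.polar q v x, (1 - Polynomial.X) ^ 2,
      Polynomial.C (-q z / QuadraticMap.polar q v x) * Polynomial.X ^ 2,
      Polynomial.X * (1 - Polynomial.X), div_ne_zero (neg_ne_zero.2 hz) hvx, fun t => ?_, ?_⟩
    · rw [quadraticForm_combination, hv, hx, hvz, hxz]
      simp only [Polynomial.eval_pow, Polynomial.eval_sub, Polynomial.eval_one, Polynomial.eval_X,
        Polynomial.eval_mul, Polynomial.eval_C]
      field_simp
      ring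
    · simp

/-- Move a vector `y` with `ℓ y ≠ 0` along an anisotropic `z` in the kernel of `ℓ` until it becomes
isotropic. Such a `z` exists because a form vanishing on a hyperplane has rank at most two. -/
theorem exists_isotropic_apply_ne_zero [IsAlgClosed K] {ℓ : V →ₗ[K] K} (hℓ : ℓ ≠ 0) :
    ∃ x, q x = 0 ∧ ℓ x ≠ 0 := by
  obtain ⟨y, hy⟩ : ∃ y, ℓ y ≠ 0 := by
    by_contra! hcon
    exact hℓ (LinearMap.ext hcon)
  obtain ⟨z, hz, hqz⟩ : ∃ z ∈ LinearMap.ker ℓ, q z ≠ 0 := by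
    by_contra! hcon
    refine absurd (finrank_le_of_functionals_polar (q := q) ℓ (q.polarBilin y) ?_) (by omega)
    intro c hc1 hc2 d
    have hd : d - (ℓ d / ℓ y) • y ∈ LinearMap.ker ℓ := by
      rw [LinearMap.mem_ker, map_sub, map_smul, smul_eq_mul, div_mul_cancel₀ _ hy, sub_self]
    have h1 := polar_eq_zero_of_forall hcon (show c ∈ LinearMap.ker ℓ from hc1) hd
    have hc2' : QuadraticMap.polar q y c = 0 := hc2
    rwa [QuadraticMap.polar_sub_right, QuadraticMap.polar_smul_right, QuadraticMap.polar_comm q c y,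
      hc2', smul_zero, sub_zero] at h1
  obtain ⟨t, ht⟩ := exists_isotropic_add_smul q.polarBilin y z (by
    rw [QuadraticMap.polarBilin_apply_apply, polar_self_eq]
    exact mul_ne_zero two_ne_zero hqz)
  rw [QuadraticMap.polarBilin_apply_apply, polar_self_eq] at ht
  refine ⟨y + t • z, (mul_eq_zero.1 ht).resolve_left two_ne_zero, ?_⟩
  rwa [map_add, map_smul, LinearMap.mem_ker.1 hz, smul_zero, add_zero]

/-- A quadratic form which vanishes at the isotropic vectors of a quadratic form of large rank is a
multiple of it. -/
theorem exists_eq_mul_of_isotropic [IsAlgClosed K] {q' : QuadraticForm K V}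
    (h : ∀ x, q x = 0 → q' x = 0) : ∃ c : K, ∀ x, q' x = c * q x := by
  obtain ⟨x₀, hx₀⟩ : ∃ x, q x ≠ 0 := by
    by_contra! hcon
    refine absurd (finrank_le_of_functionals_polar (q := q) 0 0 fun c _ _ d => ?_) (by omega)
    exact polar_eq_zero_of_forall (S := ⊤) (fun x _ => hcon x) trivial trivial
  -- The discriminant of `q` restricted to the line through `y` in direction `x₀`. If it vanished
  -- identically, every vector orthogonal to `x₀` would lie in the radical.
  set disc : V → K := fun y => QuadraticMap.polar q y x₀ ^ 2 - 4 * q x₀ * q y with hdisc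
  obtain ⟨y₁, hy₁⟩ : ∃ y, disc y ≠ 0 := by
    by_contra! hcon
    refine absurd (finrank_le_of_functionals_polar (q := q) (q.polarBilin x₀) 0
      fun c hc _ d => ?_) (by omega)
    have hc' : QuadraticMap.polar q c x₀ = 0 := by rw [QuadraticMap.polar_comm]; exact hc
    have h1 := hcon (c + d)
    have h2 := hcon c
    have h3 := hcon d
    simp only [hdisc, QuadraticMap.polar_add_left, hc'] at h1 h2 h3
    have h4 : 4 * q x₀ * QuadraticMap.polar q c d = 0 := by
      rw [QuadraticMap.polar]
      linear_combination h2 + h3 - h1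
    exact (mul_eq_zero.1 h4).resolve_left (mul_ne_zero (by norm_num) hx₀)
  set c := q' x₀ / q x₀ with hc
  set q₂ : QuadraticForm K V := q' - c • q with hq₂
  have hq₂x : ∀ x, q₂ x = q' x - c * q x := fun x => rfl
  have hq₂0 : q₂ x₀ = 0 := by rw [hq₂x, hc, div_mul_cancel₀ _ hx₀, sub_self]
  have hiso : ∀ x, q x = 0 → q₂ x = 0 := fun x hx => by rw [hq₂x, h x hx, hx, mul_zero, sub_zero]
  -- Such a line meets the quadric in two distinct points. On it `q₂` is affine in the parameter
  -- because `q₂ x₀ = 0`, so its vanishing at both points makes it zero.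
  have hgen : ∀ y, disc y ≠ 0 → q₂ y = 0 := by
    intro y hy
    obtain ⟨s, hs⟩ := IsAlgClosed.exists_pow_nat_eq (disc y) two_pos
    have hs0 : s ≠ 0 := by
      rintro rfl
      exact hy (by rw [← hs]; simp)
    have hroot : ∀ s, s ^ 2 = disc y →
        q (y + ((-QuadraticMap.polar q y x₀ + s) / (2 * q x₀)) • x₀) = 0 := by
      intro s hs
      rw [quadraticForm_add_smul]
      field_simp
      simp only [hdisc] at hs
      linear_combination hs
    have h1 := hiso _ (hroot s hs)
    have h2 := hiso _ (hroot (-s) (by rw [neg_sq, hs]))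
    rw [quadraticForm_add_smul, hq₂0] at h1 h2
    have h3 : s / q x₀ * QuadraticMap.polar q₂ y x₀ = 0 := by
      linear_combination h1 - h2
    rw [(mul_eq_zero.1 h3).resolve_left (div_ne_zero hs0 hx₀)] at h1
    linear_combination h1
  refine ⟨c, fun y => ?_⟩
  rw [← sub_eq_zero, ← hq₂x]
  -- To reach every `y`, restrict to the line `y + t y₁`: the product of `q₂` and the discriminant
  -- vanishes there, and the discriminant has leading coefficient `disc y₁ ≠ 0`.
  set A : Polynomial K := Polynomial.C (q₂ y) + Polynomial.C (QuadraticMap.polar q₂ y y₁) *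
    Polynomial.X + Polynomial.C (q₂ y₁) * Polynomial.X ^ 2 with hA
  set B : Polynomial K := Polynomial.C (disc y) + Polynomial.C
    (2 * QuadraticMap.polar q y x₀ * QuadraticMap.polar q y₁ x₀
      - 4 * q x₀ * QuadraticMap.polar q y y₁) * Polynomial.X +
    Polynomial.C (disc y₁) * Polynomial.X ^ 2 with hB
  have hAt : ∀ t, A.eval t = q₂ (y + t • y₁) := fun t => by
    rw [quadraticForm_add_smul, hA]
    simp only [Polynomial.eval_add, Polynomial.eval_mul, Polynomial.eval_C, Polynomial.eval_X,
      Polynomial.eval_pow]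
    ring
  have hBt : ∀ t, B.eval t = disc (y + t • y₁) := fun t => by
    simp only [hdisc, hB, quadraticForm_add_smul, QuadraticMap.polar_add_left,
      QuadraticMap.polar_smul_left, smul_eq_mul, Polynomial.eval_add, Polynomial.eval_mul,
      Polynomial.eval_C, Polynomial.eval_X, Polynomial.eval_pow]
    ring
  have hAB : A * B = 0 := Polynomial.funext fun t => by
    rw [Polynomial.eval_mul, hAt, hBt, Polynomial.eval_zero]
    by_cases hd : disc (y + t • y₁) = 0
    · rw [hd, mul_zero]
    · rw [hgen _ hd, zero_mul]
  have hB0 : B ≠ 0 := fun h0 => hy₁ (by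
    have := congrArg (fun p => Polynomial.coeff p 2) h0
    simpa [hB, Polynomial.coeff_X, Polynomial.coeff_C] using this)
  have hA0 := (mul_eq_zero.1 hAB).resolve_right hB0
  have := hAt 0
  rw [hA0, Polynomial.eval_zero, zero_smul, add_zero] at this
  exact this.symm

end Quadric

/-! ### Invariance of the quadratic form under a polynomial representation -/

section InvariantForm

variable {K : Type u} [Field K] [CharZero K] {ι : Type} [Fintype ι] [DecidableEq ι]

theorem exists_polynomial_quadraticForm (q : QuadraticForm K (ι → K)) (p : ι → Polynomial K) :
    ∃ r : Polynomial K, ∀ t, r.eval t = q fun i => (p i).eval t := by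
  refine ⟨Polynomial.C (1 / 2) * ∑ i, ∑ j, p i * p j *
    Polynomial.C (QuadraticMap.polar q (Pi.single i 1) (Pi.single j 1)), fun t => ?_⟩
  set x : ι → K := fun i => (p i).eval t with hx
  have h1 : q x = 1 / 2 * q.polarBilin x x := by
    rw [QuadraticMap.polarBilin_apply_apply, polar_self_eq]
    field_simp
  have h2 : x = ∑ i, x i • Pi.single i (1 : K) := by
    funext j
    simp [Pi.single_apply]
  rw [h1]
  conv_rhs => rw [h2]
  simp only [map_sum, map_smul, LinearMap.sum_apply, LinearMap.smul_apply,
    QuadraticMap.polarBilin_apply_apply, smul_eq_mul, Polynomial.eval_mul, Polynomial.eval_C,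
    Polynomial.eval_finsetSum, Finset.mul_sum]
  rw [Finset.sum_comm]
  refine Finset.sum_congr rfl fun i _ => Finset.sum_congr rfl fun j _ => ?_
  rw [hx]
  ring

variable {G : Type*} [AddCommGroup G] [Module K G] {ρ : G → Matrix ι ι K}
  {q : QuadraticForm K (ι → K)}

/-- Preserving the quadric makes `q` semi-invariant with some character `χ`. Along rays `χ` is a
polynomial without zeros, hence constantly `1`. -/
theorem quadraticForm_mulVec_eq [IsAlgClosed K]
    (hq : Module.finrank K (LinearMap.ker q.polarBilin) + 2 < Module.finrank K (ι → K))
    (hpoly : PolynomialOnRays ρ) (h0 : ρ 0 = 1) (hadd : ∀ g h, ρ (g + h) = ρ g * ρ h)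
    (hinv : ∀ g x, q x = 0 → q ((ρ g).mulVec x) = 0) (g : G) (x : ι → K) :
    q ((ρ g).mulVec x) = q x := by
  have hχ : ∀ g, ∃ c : K, ∀ x, q ((ρ g).mulVec x) = c * q x := fun g =>
    exists_eq_mul_of_isotropic hq (q' := q.comp (ρ g).mulVecLin) (hinv g)
  choose χ hχ using hχ
  obtain ⟨x₀, hx₀⟩ : ∃ x, q x ≠ 0 := by
    by_contra! hcon
    refine absurd (finrank_le_of_functionals_polar (q := q) 0 0 fun c _ _ d => ?_) (by omega)
    exact polar_eq_zero_of_forall (S := ⊤) (fun x _ => hcon x) trivial trivial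
  have hχ0 : χ 0 = 1 := by
    have := hχ 0 x₀
    rw [h0, Matrix.one_mulVec] at this
    exact mul_right_cancel₀ hx₀ (by rw [← this, one_mul])
  have hχadd : ∀ g h, χ (g + h) = χ g * χ h := by
    intro g h
    refine mul_right_cancel₀ hx₀ ?_
    rw [← hχ, hadd, ← Matrix.mulVec_mulVec, hχ, hχ, mul_assoc]
  obtain ⟨P, hP⟩ := hpoly g
  obtain ⟨r, hr⟩ := exists_polynomial_quadraticForm q
    (fun i => ∑ j, P i j * Polynomial.C (x₀ j))
  have hrt : ∀ t, r.eval t = χ (t • g) * q x₀ := by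
    intro t
    rw [hr, ← hχ, ← hP]
    congr 1
    funext i
    simp [Matrix.mulVec, dotProduct, Polynomial.eval_finsetSum]
  have h1 := eval_eq_eval_of_forall_ne_zero (p := r) (fun t => by
    rw [hrt]
    refine mul_ne_zero (fun hz => ?_) hx₀
    have := hχadd (t • g) (-(t • g))
    rw [add_neg_cancel, hχ0, hz, zero_mul] at this
    exact one_ne_zero this) 1 0
  rw [hrt, hrt, one_smul, zero_smul, hχ0] at h1
  rw [hχ, mul_right_cancel₀ hx₀ h1, one_mul]

theorem coeff_eq_of_forall_sum_eq {D : ℕ} {a b : ℕ → K}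
    (h : ∀ t : K, ∑ k ∈ Finset.range D, t ^ k * a k = ∑ k ∈ Finset.range D, t ^ k * b k) {k : ℕ}
    (hk : k < D) : a k = b k := by
  have h1 : ∑ k ∈ Finset.range D, Polynomial.X ^ k * Polynomial.C (a k) =
      ∑ k ∈ Finset.range D, Polynomial.X ^ k * Polynomial.C (b k) :=
    Polynomial.funext fun t => by
      simp only [Polynomial.eval_finsetSum, Polynomial.eval_mul, Polynomial.eval_pow,
        Polynomial.eval_X, Polynomial.eval_C]
      exact h t
  have h2 := congrArg (fun p => Polynomial.coeff p k) h1
  simpa [Polynomial.finsetSum_coeff, Polynomial.coeff_X_pow_mul', Polynomial.coeff_C,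
    Polynomial.coeff_X_pow, Finset.sum_ite_eq, hk] using h2

/-- The infinitesimal invariance of a quadratic form. -/
theorem polar_mulVec_add_eq_zero (hq : ∀ g x, q ((ρ g).mulVec x) = q x) (h0 : ρ 0 = 1)
    (hadd : ∀ g h, ρ (g + h) = ρ g * ρ h) {N : G →ₗ[K] Matrix ι ι K}
    (hN : ∀ g, ∃ D : ℕ, N g ^ D = 0 ∧
      ρ g = ∑ k ∈ Finset.range D, ((k.factorial : K)⁻¹) • N g ^ k) (g : G) (x y : ι → K) :
    QuadraticMap.polar q ((N g).mulVec x) y + QuadraticMap.polar q x ((N g).mulVec y) = 0 := by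
  obtain ⟨D, hD, -⟩ := hN g
  have hD2 : N g ^ (D + 2) = 0 := pow_eq_zero_of_le (Nat.le_add_right _ _) hD
  have hρ : ∀ t : K, ρ (t • g) = ∑ k ∈ Finset.range (D + 2),
      t ^ k • ((k.factorial : K)⁻¹) • N g ^ k := by
    intro t
    obtain ⟨E, hE, hρE⟩ := hN (t • g)
    have hD' : N (t • g) ^ (D + 2) = 0 := by rw [map_smul, smul_pow, hD2, smul_zero]
    rw [hρE, ← sum_range_eq_of_pow_eq_zero hE (le_max_left E (D + 2)) fun k => (k.factorial : K)⁻¹,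
      sum_range_eq_of_pow_eq_zero hD' (le_max_right E (D + 2)) fun k => (k.factorial : K)⁻¹]
    refine Finset.sum_congr rfl fun k _ => ?_
    rw [map_smul, smul_pow, smul_comm]
  have hpol : ∀ g x y, QuadraticMap.polar q ((ρ g).mulVec x) y =
      QuadraticMap.polar q x ((ρ (-g)).mulVec y) := by
    intro g x y
    have h1 : y = (ρ g).mulVec ((ρ (-g)).mulVec y) := by
      rw [Matrix.mulVec_mulVec, ← hadd, add_neg_cancel, h0, Matrix.one_mulVec]
    conv_lhs => rw [h1]
    rw [QuadraticMap.polar, QuadraticMap.polar, ← Matrix.mulVec_add, hq, hq, hq]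
  -- Compare the coefficients of `t` in the adjointness of `ρ (t g)` and `ρ (-t g)`. The bound `D +
  -- 2` makes `1` an admissible index even for `D = 0`.
  have h1 := coeff_eq_of_forall_sum_eq (D := D + 2) (k := 1)
    (a := fun k => ((k.factorial : K)⁻¹) * QuadraticMap.polar q ((N g ^ k).mulVec x) y)
    (b := fun k => (-1) ^ k * ((k.factorial : K)⁻¹) *
      QuadraticMap.polar q x ((N g ^ k).mulVec y)) (fun t => ?_) (by omega)
  · simp only [Nat.factorial_one, Nat.cast_one, inv_one, one_mul, pow_one, neg_mul] at h1
    rw [h1, neg_add_cancel]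
  · have h2 := hpol (t • g) x y
    rw [← neg_smul, hρ, hρ, Matrix.sum_mulVec, Matrix.sum_mulVec,
      ← QuadraticMap.polarBilin_apply_apply, ← QuadraticMap.polarBilin_apply_apply, map_sum,
      LinearMap.sum_apply, map_sum] at h2
    simp only [Matrix.smul_mulVec, map_smul, LinearMap.smul_apply, smul_eq_mul,
      QuadraticMap.polarBilin_apply_apply] at h2
    rw [h2]
    refine Finset.sum_congr rfl fun k _ => ?_
    rw [neg_pow]
    ring

end InvariantForm

/-! ### Local algebras generated by nilpotent elements -/

section NilpotentGenerators

variable {K : Type u} [Field K] {R : Type w} [CommRing R] [Algebra K R]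

theorem exists_isNilpotent_sub_smul_one {s : Set R} (hs : ∀ a ∈ s, IsNilpotent a)
    (hgen : Algebra.adjoin K s = ⊤) (r : R) : ∃ c : K, IsNilpotent (r - c • 1) := by
  have hr : r ∈ Algebra.adjoin K s := hgen ▸ Algebra.mem_top
  induction hr using Algebra.adjoin_induction with
  | mem a ha => exact ⟨0, by simpa using hs a ha⟩
  | algebraMap c => exact ⟨c, by simp [Algebra.algebraMap_eq_smul_one]⟩
  | add x y _ _ hx hy =>
    obtain ⟨c, hc⟩ := hx
    obtain ⟨d, hd⟩ := hy
    refine ⟨c + d, ?_⟩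
    have := (Commute.all _ _).isNilpotent_add hc hd
    rwa [add_smul, add_sub_add_comm]
  | mul x y _ _ hx hy =>
    obtain ⟨c, hc⟩ := hx
    obtain ⟨d, hd⟩ := hy
    refine ⟨c * d, ?_⟩
    have h1 : x * y - (c * d) • 1 = (x - c • 1) * y + c • (y - d • 1) := by
      rw [sub_mul, smul_mul_assoc, one_mul, smul_sub, smul_smul]
      abel
    rw [h1]
    exact (Commute.all _ _).isNilpotent_add ((Commute.all _ _).isNilpotent_mul_right hc)
      (hd.smul c)

theorem isLocalRing_of_adjoin_eq_top [Nontrivial R] {s : Set R} (hs : ∀ a ∈ s, IsNilpotent a)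
    (hgen : Algebra.adjoin K s = ⊤) : IsLocalRing R := by
  refine IsLocalRing.of_isUnit_or_isUnit_one_sub_self fun r => ?_
  obtain ⟨c, hc⟩ := exists_isNilpotent_sub_smul_one hs hgen r
  rcases eq_or_ne c 0 with rfl | hc0
  · rw [zero_smul, sub_zero] at hc
    exact Or.inr hc.isUnit_one_sub
  · have hu : IsUnit (c • (1 : R)) := by
      rw [← Algebra.algebraMap_eq_smul_one]
      exact (IsUnit.mk0 c hc0).map _
    left
    have := hc.isUnit_add_left_of_commute hu (Commute.all _ _)
    rwa [add_sub_cancel] at this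

variable [IsLocalRing R]

theorem finrank_maximalIdeal_add_one [IsAlgClosed K] [Module.Finite K R] :
    Module.finrank K (IsLocalRing.maximalIdeal R) + 1 = Module.finrank K R := by
  set M : Submodule K R := (IsLocalRing.maximalIdeal R).restrictScalars K with hM
  have h1 : IsCompl M (K ∙ (1 : R)) := by
    constructor
    · rw [Submodule.disjoint_def]
      intro x hx hx1
      obtain ⟨c, rfl⟩ := Submodule.mem_span_singleton.1 hx1
      rcases eq_or_ne c 0 with rfl | hc
      · exact zero_smul _ _
      · refine absurd (M.smul_mem c⁻¹ hx) ?_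
        rw [smul_smul, inv_mul_cancel₀ hc, one_smul]
        exact fun h => (IsLocalRing.mem_maximalIdeal _).1 h isUnit_one
    · rw [codisjoint_iff, eq_top_iff]
      intro x _
      obtain ⟨c, hc⟩ := exists_sub_smul_one_mem_maximalIdeal (K := K) x
      rw [← sub_add_cancel x (c • 1)]
      exact Submodule.add_mem_sup hc (Submodule.smul_mem _ _ (Submodule.mem_span_singleton_self 1))
  have h2 := Submodule.finrank_add_eq_of_isCompl h1
  rwa [finrank_span_singleton one_ne_zero] at h2

/-- Both nondegeneracy clauses come from rank at least four. If `F` vanished on 𝔪 × 𝔪, the kernel of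
`F 1` on 𝔪 would lie in the radical, and a product of two linear forms has rank at most two. -/
theorem isInvariantTriple_of_finrank_ker [IsAlgClosed K] [CharZero K] [Module.Finite K R]
    {W : Submodule K R} {F : LinearMap.BilinForm K R}
    (hnil : ∀ a ∈ W, IsNilpotent a) (hgen : Algebra.adjoin K (W : Set R) = ⊤)
    (hW : Module.finrank K W + 2 = Module.finrank K R) (hsymm : ∀ a b, F a b = F b a)
    (h11 : F 1 1 = 0) (hinv : ∀ a ∈ W, ∀ b c, F (a * b) c + F b (a * c) = 0)
    (hrk : Module.finrank K (LinearMap.ker F) + 3 < Module.finrank K R) :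
    IsInvariantTriple W F where
  finite := inferInstance
  le_maximalIdeal a ha := (IsLocalRing.mem_maximalIdeal _).2 fun hu =>
    hu.not_isNilpotent (hnil a ha)
  hyperplane := by
    have := finrank_maximalIdeal_add_one (K := K) (R := R)
    omega
  generates := hgen
  symm := hsymm
  one_one := h11
  ne_zero := by
    by_contra! hcon
    have h1 := finrank_le_of_functionals
      (W := (IsLocalRing.maximalIdeal R).restrictScalars K) (N := LinearMap.ker F) (F 1) 0 ?_
    · have h2 := finrank_maximalIdeal_add_one (K := K) (R := R)
      change Module.finrank K (IsLocalRing.maximalIdeal R) ≤ _ at h1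
      omega
    · intro c hc hc1 _
      rw [mem_ker_bilin_iff]
      intro b
      obtain ⟨d, hd⟩ := exists_sub_smul_one_mem_maximalIdeal (K := K) b
      have h3 := hcon c hc _ hd
      rwa [map_sub, map_smul, hsymm c 1, hc1, smul_zero, sub_zero] at h3
  invariant := hinv
  irreducible := by
    rintro ⟨ℓ₁, ℓ₂, hℓ⟩
    have h1 := finrank_le_of_functionals (W := ⊤) (N := LinearMap.ker F) ℓ₁ ℓ₂ ?_
    · rw [finrank_top] at h1
      omega
    · intro c _ hc1 hc2
      rw [mem_ker_bilin_iff]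
      intro b
      have h2 := hℓ (c + b)
      have h3 := hℓ c
      have h4 := hℓ b
      simp only [map_add, LinearMap.add_apply, hc1, hc2, zero_add, zero_mul] at h2 h3
      rw [h3, h4, hsymm b c] at h2
      have h5 : 2 * F c b = 0 := by linear_combination h2
      exact (mul_eq_zero.1 h5).resolve_left two_ne_zero

end NilpotentGenerators

/-! ### Basic open sets of the Zariski topology -/

section ZariskiBasis

variable {K : Type u} [Field K] {m : ℕ}

theorem exists_homogeneous_of_isOpen {U : Set (Proj K m)} (hU : IsOpen[zariski K m] U)
    {x : Proj K m} (hx : x ∈ U) :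
    ∃ (d : ℕ) (f : MvPolynomial (Fin (m + 1)) K), f.IsHomogeneous d ∧
      MvPolynomial.eval x.rep f ≠ 0 ∧
      ∀ y : Proj K m, MvPolynomial.eval y.rep f ≠ 0 → y ∈ U := by
  have hU' : TopologicalSpace.GenerateOpen {U | ∃ (d : ℕ) (f : MvPolynomial (Fin (m + 1)) K),
      f.IsHomogeneous d ∧ U = {x : Proj K m | MvPolynomial.eval x.rep f ≠ 0}} U := hU
  induction hU' with
  | basic V hV =>
    obtain ⟨d, f, hf, rfl⟩ := hV
    exact ⟨d, f, hf, hx, fun y hy => hy⟩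
  | univ => exact ⟨0, 1, MvPolynomial.isHomogeneous_one _ _, by simp, fun y _ => Set.mem_univ y⟩
  | inter V₁ V₂ h₁ h₂ ih₁ ih₂ =>
    obtain ⟨d₁, f₁, hf₁, hx₁, hy₁⟩ := ih₁ h₁ hx.1
    obtain ⟨d₂, f₂, hf₂, hx₂, hy₂⟩ := ih₂ h₂ hx.2
    refine ⟨d₁ + d₂, f₁ * f₂, hf₁.mul hf₂, ?_, fun y hy => ?_⟩
    · rw [map_mul]
      exact mul_ne_zero hx₁ hx₂
    · rw [map_mul] at hy
      exact ⟨hy₁ y (left_ne_zero_of_mul hy), hy₂ y (right_ne_zero_of_mul hy)⟩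
  | sUnion S hS ih =>
    obtain ⟨V, hVS, hxV⟩ := hx
    obtain ⟨d, f, hf, hxf, hy⟩ := ih V hVS (hS V hVS) hxV
    exact ⟨d, f, hf, hxf, fun y hyf => ⟨V, hVS, hy y hyf⟩⟩

end ZariskiBasis

/-! ### The algebra of an additive action -/

section Existence

variable {K : Type u} [Field K]

theorem polynomialOnRays_map_eval {n : ℕ} {ι : Type}
    (M : Matrix ι ι (MvPolynomial (Fin n) K)) :
    PolynomialOnRays fun g : Fin n → K => M.map (MvPolynomial.eval g) := by
  intro g
  refine ⟨M.map (MvPolynomial.aeval fun i => Polynomial.C (g i) * Polynomial.X), fun t => ?_⟩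
  ext i j
  simp only [Matrix.map_apply]
  rw [← Polynomial.coe_evalRingHom, MvPolynomial.aeval_def, MvPolynomial.hom_eval₂,
    MvPolynomial.eval, MvPolynomial.coe_eval₂Hom]
  congr 1
  · ext c; simp
  · funext i
    simp only [map_mul, Polynomial.coe_evalRingHom, Polynomial.eval_C,
      Polynomial.eval_X, Pi.smul_apply, smul_eq_mul]
    exact mul_comm _ _

/-- An additive action on a hyperquadric is given by the exponentials of a commutative vector space
of nilpotent matrices, which are skew-symmetric with respect to the quadratic form. -/
theorem AdditiveAction.exists_linearMap_exp [IsAlgClosed K] [CharZero K] {n m : ℕ}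
    {q : QuadraticForm K (Fin (m + 1 + 1) → K)}
    (hq : Module.finrank K (LinearMap.ker q.polarBilin) + 2 <
      Module.finrank K (Fin (m + 1 + 1) → K))
    (A : AdditiveAction n (hyperquadric q)) :
    ∃ (N : (Fin n → K) →ₗ[K] Matrix (Fin (m + 1 + 1)) (Fin (m + 1 + 1)) K)
      (ρ : (Fin n → K) → Matrix (Fin (m + 1 + 1)) (Fin (m + 1 + 1)) K),
      Function.Injective N ∧ (∀ g h, N g * N h = N h * N g) ∧
      (∀ g, ∃ D : ℕ, N g ^ D = 0 ∧
        ρ g = ∑ k ∈ Finset.range D, ((k.factorial : K)⁻¹) • N g ^ k) ∧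
      (∀ g v (hv : v ≠ 0), ∃ h : (ρ g).mulVec v ≠ 0,
        A.act g (Projectivization.mk K v hv) = Projectivization.mk K ((ρ g).mulVec v) h) ∧
      ∀ g x y, QuadraticMap.polar q ((N g).mulVec x) y +
        QuadraticMap.polar q x ((N g).mulVec y) = 0 := by
  obtain ⟨M, hM0, hM⟩ := exists_matrix_of_isMorphism A.isMorphism A.act_zero
  set ρ : (Fin n → K) → Matrix (Fin (m + 1 + 1)) (Fin (m + 1 + 1)) K :=
    fun g => M.map (MvPolynomial.eval g) with hρ
  have hpoly : PolynomialOnRays ρ := polynomialOnRays_map_eval M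
  have hinj : ∀ g v, v ≠ 0 → (ρ g).mulVec v ≠ 0 := fun g v hv => (hM g v hv).1
  have hadd : ∀ g h, ρ (g + h) = ρ g * ρ h := by
    refine map_add_of_projective hpoly hM0 hinj fun g h v => ?_
    rcases eq_or_ne v 0 with rfl | hv
    · exact ⟨0, by simp⟩
    obtain ⟨h1, e1⟩ := hM h v hv
    obtain ⟨h2, e2⟩ := hM g _ h1
    obtain ⟨h3, e3⟩ := hM (g + h) v hv
    rw [A.act_add, e1, e2, Projectivization.mk_eq_mk_iff'] at e3
    obtain ⟨c, hc⟩ := e3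
    exact ⟨c, hc⟩
  obtain ⟨N, hNcomm, hN⟩ := AddAct.exists_linearMap_exp hpoly hM0 hadd
  have hinv : ∀ g x, q x = 0 → q ((ρ g).mulVec x) = 0 := by
    intro g x hx
    rcases eq_or_ne x 0 with rfl | hx0
    · rw [Matrix.mulVec_zero, QuadraticMap.map_zero]
    obtain ⟨h1, e1⟩ := hM g x hx0
    have := A.invariant g _ ((mk_mem_hyperquadric_iff hx0).2 hx)
    rwa [e1, mk_mem_hyperquadric_iff] at this
  have hqρ := quadraticForm_mulVec_eq hq hpoly hM0 hadd hinv
  refine ⟨N, ρ, ?_, hNcomm, hN, hM, polar_mulVec_add_eq_zero hqρ hM0 hadd hN⟩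
  rw [injective_iff_map_eq_zero]
  intro g hg
  refine A.effective g fun x => ?_
  have h1 : ρ g = 1 := by
    obtain ⟨D, hD, e⟩ := hN g
    rw [hg] at hD e
    rw [e, ← sum_range_eq_of_pow_eq_zero hD (Nat.le_succ D), Finset.sum_range_succ']
    simp
  induction x using Projectivization.ind with
  | h v hv =>
    obtain ⟨h2, e2⟩ := hM g v hv
    rw [e2, Projectivization.mk_eq_mk_iff']
    exact ⟨1, by rw [one_smul]; change _ = (ρ g).mulVec v; rw [h1, Matrix.one_mulVec]⟩

theorem exists_commRing_of_commute {G : Type*} [AddCommGroup G] [Module K G] {B : Type w} [Ring B]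
    [Algebra K B] (N : G →ₗ[K] B) (hN : ∀ g h, N g * N h = N h * N g) :
    ∃ (R : Type w) (_ : CommRing R) (_ : Algebra K R) (i : R →ₐ[K] B) (N' : G →ₗ[K] R),
      Function.Injective i ∧ (∀ g, i (N' g) = N g) ∧ Algebra.adjoin K (Set.range N') = ⊤ := by
  set S := Algebra.adjoin K (Set.range N) with hS
  have hmem : ∀ g, N g ∈ S := fun g => Algebra.subset_adjoin ⟨g, rfl⟩
  have hcomm : ∀ a ∈ Set.range N, ∀ b ∈ Set.range N, a * b = b * a := by
    rintro _ ⟨g, rfl⟩ _ ⟨h, rfl⟩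
    exact hN g h
  have : IsMulCommutative S := Algebra.isMulCommutative_adjoin K hcomm
  let _ : CommRing S := { (inferInstance : Ring S) with mul_comm := mul_comm' }
  refine ⟨S, inferInstance, inferInstance, S.val,
    LinearMap.codRestrict (Subalgebra.toSubmodule S) N hmem, Subtype.val_injective,
    fun g => rfl, ?_⟩
  rw [← Algebra.adjoin_adjoin_coe_preimage]
  congr 1
  ext ⟨x, hx⟩
  simp only [Set.mem_range, Set.mem_preimage, Subtype.ext_iff]
  rfl

/-- A linear form that vanishes on the cone over the open orbit is zero. -/
theorem eq_zero_of_forall_mem_openOrbit [IsAlgClosed K] [CharZero K] {n m : ℕ}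
    {q : QuadraticForm K (Fin (m + 1) → K)}
    (hq : Module.finrank K (LinearMap.ker q.polarBilin) + 2 < Module.finrank K (Fin (m + 1) → K))
    (A : AdditiveAction n (hyperquadric q)) {ℓ : (Fin (m + 1) → K) →ₗ[K] K}
    (hℓ : ∀ v (hv : v ≠ 0), Projectivization.mk K v hv ∈ A.openOrbit → ℓ v = 0) : ℓ = 0 := by
  obtain ⟨x₀, hx₀, hO⟩ := A.openOrbit_isOrbit
  obtain ⟨U, hU, hOU⟩ := A.openOrbit_isOpen
  have hxO : x₀ ∈ A.openOrbit := hO ▸ ⟨0, A.act_zero x₀⟩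
  obtain ⟨d, f, hf, hfx, hfU⟩ := exists_homogeneous_of_isOpen hU (hOU ▸ hxO : x₀ ∈ _ ∩ U).2
  by_contra hne
  obtain ⟨x, hx, hℓx⟩ := exists_isotropic_apply_ne_zero hq hne
  obtain ⟨z, b, p₁, p₂, p₃, hb, hcurve, h10, h20, h30, h11, h21, h31⟩ :=
    exists_isotropic_curve hq (v := x₀.rep) hx₀ hx
  set r₁ : Polynomial K := MvPolynomial.aeval (fun i => p₁ * Polynomial.C (x₀.rep i) +
    p₂ * Polynomial.C (x i) + p₃ * Polynomial.C (z i)) f with hr₁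
  set r₂ : Polynomial K := p₁ * Polynomial.C (ℓ x₀.rep) + p₂ * Polynomial.C (ℓ x) +
    p₃ * Polynomial.C (ℓ z) with hr₂
  have e₁ : ∀ t, r₁.eval t =
      MvPolynomial.eval (p₁.eval t • x₀.rep + p₂.eval t • x + p₃.eval t • z) f := by
    intro t
    rw [hr₁, ← Polynomial.coe_evalRingHom, MvPolynomial.aeval_def, MvPolynomial.hom_eval₂,
      MvPolynomial.eval, MvPolynomial.coe_eval₂Hom]
    congr 1
    · ext c; simp
    · funext i; simp
  have e₂ : ∀ t, r₂.eval t = ℓ (p₁.eval t • x₀.rep + p₂.eval t • x + p₃.eval t • z) := by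
    intro t
    simp [hr₂]
  -- On the isotropic curve from `x₀` to a multiple of `x`, points with `f ≠ 0` lie in the open
  -- orbit, where `ℓ` vanishes. So the product is zero, although `f` is nonzero at `t = 0` and `ℓ`
  -- at `t = 1`.
  have hprod : r₁ * r₂ = 0 := by
    refine Polynomial.funext fun t => ?_
    rw [Polynomial.eval_mul, Polynomial.eval_zero, e₁, e₂]
    set y := p₁.eval t • x₀.rep + p₂.eval t • x + p₃.eval t • z with hy
    by_contra hmul
    have hfy := left_ne_zero_of_mul hmul
    have hℓy := right_ne_zero_of_mul hmul
    have hy0 : y ≠ 0 := by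
      intro h0
      rw [h0, map_zero] at hℓy
      exact hℓy rfl
    refine hℓy (hℓ y hy0 ?_)
    rw [hOU]
    exact ⟨(mk_mem_hyperquadric_iff hy0).2 (hcurve t),
      hfU _ ((eval_rep_mk_ne_zero_iff hf hy0).2 hfy)⟩
  rcases mul_eq_zero.1 hprod with h | h
  · have := e₁ 0
    rw [h, h10, h20, h30, one_smul, zero_smul, zero_smul, add_zero, add_zero,
      Polynomial.eval_zero] at this
    exact hfx this.symm
  · have := e₂ 1
    rw [h, h11, h21, h31, zero_smul, zero_smul, zero_add, add_zero, map_smul,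
      Polynomial.eval_zero] at this
    exact mul_ne_zero hb hℓx this.symm

/-- An additive action on a hyperquadric of corank two is represented by the algebra generated by
the infinitesimal action. -/
theorem exists_represents [IsAlgClosed K] [CharZero K] {n : ℕ} (hn : 5 ≤ n)
    {q : QuadraticForm K (Fin (n + 1 + 1) → K)} (hq : corank q = 2)
    (A : AdditiveAction n (hyperquadric q)) :
    ∃ (R : Type u) (_ : CommRing R) (_ : IsLocalRing R) (_ : Algebra K R)
      (W : Submodule K R) (F : LinearMap.BilinForm K R), Represents W F A := by
  have hdim : Module.finrank K (Fin (n + 1 + 1) → K) = n + 2 := by simp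
  have hrk : Module.finrank K (LinearMap.ker q.polarBilin) + 2 <
      Module.finrank K (Fin (n + 1 + 1) → K) := by
    rw [hdim, show Module.finrank K (LinearMap.ker q.polarBilin) = 2 from hq]
    omega
  obtain ⟨N, ρ, hNinj, hNcomm, hNρ, hact, hpol⟩ := A.exists_linearMap_exp hrk
  obtain ⟨R, _, _, i, N', hi, hiN, hgen⟩ := exists_commRing_of_commute N hNcomm
  obtain ⟨x₀, hx₀, hO⟩ := A.openOrbit_isOrbit
  set v := x₀.rep with hv
  have hv0 : v ≠ 0 := x₀.rep_nonzero
  have hxv : Projectivization.mk K v hv0 = x₀ := x₀.mk_rep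
  set L : R →ₗ[K] (Fin (n + 1 + 1) → K) :=
    LinearMap.applyₗ v ∘ₗ Matrix.toLin'.toLinearMap ∘ₗ i.toLinearMap with hL
  have hLv : ∀ r, L r = (i r).mulVec v := fun r => rfl
  have hLmul : ∀ r s, L (r * s) = (i r).mulVec (L s) := fun r s => by
    rw [hLv, hLv, map_mul, Matrix.mulVec_mulVec]
  -- The image is a linear subspace containing the cone over the open orbit, so no nonzero linear
  -- form vanishes on it.
  have hsurj : Function.Surjective L := by
    rw [← LinearMap.range_eq_top]
    by_contra hlt
    obtain ⟨ℓ, hℓ0, hℓ⟩ := Submodule.exists_le_ker_of_lt_top _ (lt_top_iff_ne_top.2 hlt)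
    refine hℓ0 (eq_zero_of_forall_mem_openOrbit hrk A fun y hy hyO => hℓ ?_)
    rw [hO] at hyO
    obtain ⟨g, hg⟩ := hyO
    obtain ⟨h1, e1⟩ := hact g v hv0
    dsimp only at hg
    rw [← hxv, e1, eq_comm, Projectivization.mk_eq_mk_iff'] at hg
    obtain ⟨c, rfl⟩ := hg
    obtain ⟨D, -, e⟩ := hNρ g
    refine ⟨c • ∑ k ∈ Finset.range D, ((k.factorial : K)⁻¹) • N' g ^ k, ?_⟩
    rw [map_smul, hLv, e, map_sum]
    simp [hiN]
  -- If `r` kills `v`, commutativity makes it kill all of `R v`, the whole space, so `r` is the zero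
  -- matrix.
  have hinj : Function.Injective L := by
    rw [injective_iff_map_eq_zero]
    intro r hr
    refine hi ?_
    rw [map_zero, ← Matrix.mulVec_injective.eq_iff (b := 0)]
    funext y
    obtain ⟨s, rfl⟩ := hsurj y
    rw [← hLmul, mul_comm, hLmul, hr, Matrix.mulVec_zero, Matrix.zero_mulVec]
  set φ : R ≃ₗ[K] (Fin (n + 1 + 1) → K) := LinearEquiv.ofBijective L ⟨hinj, hsurj⟩ with hφ
  have hφL : ∀ r, φ r = L r := fun r => rfl
  have hφ1 : φ 1 = v := by rw [hφL, hLv, map_one, Matrix.one_mulVec]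
  have : Module.Finite K R := Module.Finite.equiv φ.symm
  have : Nontrivial R := φ.toEquiv.nontrivial
  have hdimR : Module.finrank K R = n + 2 := φ.finrank_eq.trans hdim
  have hnil : ∀ a ∈ LinearMap.range N', IsNilpotent a := by
    rintro _ ⟨g, rfl⟩
    obtain ⟨D, hD, -⟩ := hNρ g
    exact ⟨D, hi (by rw [map_pow, hiN, hD, map_zero])⟩
  have hgen' : Algebra.adjoin K (LinearMap.range N' : Set R) = ⊤ := by
    rwa [LinearMap.coe_range]
  have : IsLocalRing R := isLocalRing_of_adjoin_eq_top hnil hgen'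
  have hN'inj : Function.Injective N' := fun g h hgh => hNinj (by rw [← hiN, hgh, hiN])
  set F : LinearMap.BilinForm K R := q.polarBilin.compl₁₂ L L with hF
  have hFapp : ∀ a b, F a b = QuadraticMap.polar q (L a) (L b) := fun a b => rfl
  have hFsymm : ∀ a b, F a b = F b a := fun a b => by
    rw [hFapp, hFapp, QuadraticMap.polar_comm]
  have hqF : ∀ r, q (φ r) = 1 / 2 * F r r := fun r => by
    rw [hFapp, polar_self_eq, hφL]
    field_simp
  have hkerF := finrank_ker_eq_corank hFsymm φ (c := 1 / 2) (by norm_num) hqF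
  have hrange : Module.finrank K (LinearMap.range N') = n := by
    rw [LinearMap.finrank_range_of_inj hN'inj]
    simp
  refine ⟨R, inferInstance, inferInstance, inferInstance, LinearMap.range N', F,
    isInvariantTriple_of_finrank_ker hnil hgen' (by omega) hFsymm ?_ ?_ (by omega), φ,
    (Pi.basisFun K (Fin n)).map (LinearEquiv.ofInjective N' hN'inj), ?_,
    ⟨1 / 2, by norm_num, hqF⟩, hφ1 ▸ hv0, ?_⟩
  · have := hqF 1
    rw [hφ1, show q v = 0 from hx₀] at this
    simpa using this.symm
  · rintro _ ⟨g, rfl⟩ b c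
    rw [hFapp, hFapp, hLmul, hLmul, hiN]
    exact hpol g _ _
  · intro g r hr hr'
    have hsum : ∑ j, g j • (((Pi.basisFun K (Fin n)).map
        (LinearEquiv.ofInjective N' hN'inj) j : LinearMap.range N') : R) = N' g := by
      conv_rhs => rw [← (Pi.basisFun K (Fin n)).sum_repr g, map_sum]
      simp
    obtain ⟨h1, e1⟩ := hact g (φ r) hr
    obtain ⟨D, hD, e⟩ := hNρ g
    have hexp : i (nilExp K (N' g)) = ρ g := by
      rw [nilExp_eq_sum (D := D) (hi (by rw [map_pow, hiN, hD, map_zero])), e, map_sum]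
      simp [hiN]
    rw [e1]
    congr 1
    rw [hsum, mul_comm, hφL, hφL, hLmul, hexp]
  · rw [hO]
    simp only [hφ1, hxv]
    rfl

end Existence

end AddAct

end

/-- For an additive action on a hyperquadric of corank two of dimension `n ≥ 5` with unfixed
singularities: it is represented by a triple `(R, W, F)`, and for every such triple, `dim 𝔪²` is the
maximal dimension of the orbits in the boundary. -/
theorem proposition4p8 {K : Type u} [Field K] [IsAlgClosed K] [CharZero K]
    (n : ℕ) (hn : 5 ≤ n)
    (q : QuadraticForm K (Fin (n + 1 + 1) → K)) (hq : AddAct.corank q = 2)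
    (A : AddAct.AdditiveAction n (AddAct.hyperquadric q))
    (hsing : ¬ AddAct.singularLocus q ⊆ A.fixedPoints) :
    (∃ (R : Type u) (_ : CommRing R) (_ : IsLocalRing R) (_ : Algebra K R)
      (W : Submodule K R) (F : LinearMap.BilinForm K R), AddAct.Represents W F A) ∧
    ∀ (R : Type w) [CommRing R] [IsLocalRing R] [Algebra K R]
      (W : Submodule K R) (F : LinearMap.BilinForm K R), AddAct.Represents W F A →
      IsGreatest A.boundaryOrbitDims
        ((Module.finrank K ↥((IsLocalRing.maximalIdeal R) ^ 2) : ℕ) : WithBot ℕ∞) := by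
  refine ⟨AddAct.exists_represents hn hq A, fun R _ _ _ W F hrep => ?_⟩
  exact AddAct.isGreatest_boundaryOrbitDims hn hq hsing hrep
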